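/- **Monotone bandits.** There are finitely many arms. Arm $i$ has a finite non-empty state space $\mathcal S_i$, rewards $r^i_k\ge 0$, escape probabilities $f^i_k(t)\in[0,1]$ ($t=1,2,\dots$) nondecreasing in $t$, and numbers $q^i(k,j)\ge 0$ with $\sum_{j\ne k}q^i(k,j)\le 1$. Each $f^i_k$ is piecewise linear: there is a finite set $\mathcal W^i_k\ni 1$ of breakpoints such that $f^i_k$ is linear between consecutive breakpoints and constant from the last one on. For each $i$ the directed graph on $\mathcal S_i$ with edges $(j,k)$, $q^i(j,k)>0$, is strongly connected. In each step at most one arm is played; an arm that is not played keeps its state and yields nothing. If arm $i$ is in state $k$ and is played $t\ge1$ steps after it was last played (after the start, if it was never played; $t=1$ in the first step), it yields $r^i_k$, moves to $j\neq k$ with probability $f^i_k(t)q^i(k,j)$, and otherwise stays in $k$. A policy may be randomized and depend on the whole history, and start states may be chosen. $R_T$ is the total reward of the first $T$ steps. Let $OPT$ be the optimal value of Whittle's linear program: maximize $\sum_{i,k,t\ge1}r^i_kx^i_{kt}$ over $x\ge0$ subject to $\sum_{i,k,t}x^i_{kt}\le1$; $\sum_{k,t}t\,x^i_{kt}\le1$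 for all $i$; and $\sum_{j\ne k}\sum_t x^i_{kt}q^i(k,j)f^i_k(t)=\sum_{j\ne k}\sum_t x^i_{jt}q^i(j,k)f^i_j(t)$ for all $i,k$. Put $\Delta P^i_k=\sum_{j\ne k}q^i(k,j)(p^i_j-p^i_k)$. The balanced dual LP (Balance) is: minimize $\lambda+\sum_ih_i$ over $\lambda,h_i\ge0$ and $p^i_k\in\mathbb R$ subject to $\lambda=\sum_ih_i$ and $$\lambda+t\,h_i\ \ge\ r^i_k+f^i_k(t)\,\Delta P^i_k\qquad\text{for all } i,\ k\in\mathcal S_i,\ t\in\mathcal W^i_k.$$ **BalancedIndex policy** for an optimal solution $(\lambda,h,p)$ of (Balance). Only arms with $h_i>0$ are played. (a) Suppose that for every such arm $i$ and every $k\in\mathcal S_i$ the above constraint is tight for some $t\in\mathcal W^i_k$; let $t^i_k$ be the smallest such $t$. Call $k$ good if $\Delta P^i_k<0$; call arm $i$ ready if its state $k$ is not good and it has been there, since its last play, for at least $t^i_k$ steps. From any start states: if the arm played in the previous step is now in a good state, play it again; otherwise, if some arm is in a good state, play such an arm; otherwise play any ready arm; if there is none, do not play. (b) Otherwise, choose an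 arm $i$ with $h_i>0$ and a state $j\in\mathcal S_i$ with $f^i_j(1)=0$ and $r^i_j=\lambda+h_i$, start arm $i$ in $j$, and play it in every step. **Theorem.** (Balance) has an optimal solution. For every optimal solution a BalancedIndex policy exists (in particular, the choice in (b) is possible when it is needed), and every BalancedIndex policy, however ties are broken, satisfies $$\liminf_{T\to\infty}\frac{\mathbb E[R_T]}{T}\ \ge\ \frac{OPT}{2},$$ and is a $2$-approximation: for every policy $\pi'$ and all start states, $\limsup_{T\to\infty}\mathbb E_{\pi'}[R_T]/T\le 2\liminf_{T\to\infty}\mathbb E[R_T]/T$. -/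

import Mathlib

open Filter

noncomputable section

/-- A Monotone bandit with (finite) set of arms `ι` and state spaces `S i`.  Times are positive
integers.  The values `q i k k` on the diagonal are never used. -/
structure MonotoneBandit (ι : Type*) (S : ι → Type*) [Fintype ι] [DecidableEq ι]
    [∀ i, Fintype (S i)] [∀ i, DecidableEq (S i)] where
  /-- reward `r^i_k` for playing arm `i` in state `k` -/
  r : ∀ i, S i → ℝ
  /-- escape probability `f^i_k(t)` -/
  f : ∀ i, S i → ℕ+ → ℝ
  /-- distribution `q^i(k, j)` of the new state, given an escape -/
  q : ∀ i, S i → S i → ℝ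
  /-- breakpoints of the piecewise linear function `f^i_k` -/
  W : ∀ i, S i → Finset ℕ+
  r_nonneg : ∀ i k, 0 ≤ r i k
  f_nonneg : ∀ i k t, 0 ≤ f i k t
  f_le_one : ∀ i k t, f i k t ≤ 1
  q_nonneg : ∀ i k j, 0 ≤ q i k j
  q_sum_le_one : ∀ i k, ∑ j ∈ Finset.univ.erase k, q i k j ≤ 1
  /-- the Monotone property -/
  f_mono : ∀ i k t, f i k t ≤ f i k (t + 1)
  one_mem_W : ∀ i k, 1 ∈ W i k
  /-- linear interpolation between consecutive breakpoints -/
  f_interp : ∀ i k, ∀ t₁ ∈ W i k, ∀ t₂ ∈ W i k, t₁ < t₂ →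
    (∀ u ∈ W i k, u ≤ t₁ ∨ t₂ ≤ u) → ∀ t : ℕ+, t₁ < t → t < t₂ →
      f i k t = (((t₂ : ℝ) - (t : ℝ)) * f i k t₁ + ((t : ℝ) - (t₁ : ℝ)) * f i k t₂)
        / ((t₂ : ℝ) - (t₁ : ℝ))
  /-- constant from the last breakpoint on -/
  f_tail : ∀ i k, ∀ t₁ ∈ W i k, (∀ u ∈ W i k, u ≤ t₁) → ∀ t : ℕ+, t₁ ≤ t →
      f i k t = f i k t₁
  /-- for each arm the graph with edges `q i a b > 0` is strongly connected -/
  connected : ∀ i (j k : S i), Relation.ReflTransGen (fun a b => 0 < q i a b) j k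

/-- A triple `(λ, h, p)` of dual variables. -/
structure BalanceVars (ι : Type*) (S : ι → Type*) where
  lam : ℝ
  h : ι → ℝ
  p : ∀ i, S i → ℝ

namespace MonotoneBandit

variable {ι : Type*} {S : ι → Type*} [Fintype ι] [DecidableEq ι]
  [∀ i, Fintype (S i)] [∀ i, DecidableEq (S i)]

/-! ### The controlled stochastic process -/

/-- Joint configuration: for each arm its state and the number `y ≥ 1` of steps since it was last
played (or since the start): an arm that is played now is played after `y` steps. -/
abbrev Config (S : ι → Type*) : Type _ := ∀ i, S i × ℕ+

/-- The past of the process: configurations and actions, most recent first.  The action `none`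
means that no arm is played. -/
abbrev History (S : ι → Type*) : Type _ := List (Config S × Option ι)

/-- A (history dependent, randomized) policy; it plays at most one arm in each step. -/
abbrev Policy (S : ι → Type*) : Type _ := History S → Config S → PMF (Option ι)

/-- The initial configuration with chosen start states. -/
def start (s : ∀ i, S i) : Config S := fun i => (s i, 1)

/-- Probability to move from `k` to `j` when arm `i` is played in state `k` after `t` steps. -/
def transProb (B : MonotoneBandit ι S) (i : ι) (k : S i) (t : ℕ+) (j : S i) : ℝ :=
  if j = k then 1 - ∑ l ∈ Finset.univ.erase k, B.f i k t * B.q i k l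
  else B.f i k t * B.q i k j

theorem transProb_nonneg (B : MonotoneBandit ι S) (i : ι) (k : S i) (t : ℕ+) (j : S i) :
    0 ≤ B.transProb i k t j := by
  unfold transProb
  split_ifs
  · rw [← Finset.mul_sum]
    have h1 := B.q_sum_le_one i k
    have h2 := B.f_le_one i k t
    have h3 := B.f_nonneg i k t
    have h4 : 0 ≤ ∑ l ∈ Finset.univ.erase k, B.q i k l :=
      Finset.sum_nonneg fun l _ => B.q_nonneg i k l
    nlinarith
  · exact mul_nonneg (B.f_nonneg i k t) (B.q_nonneg i k j)

theorem transProb_sum (B : MonotoneBandit ι S) (i : ι) (k : S i) (t : ℕ+) :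
    ∑ j, B.transProb i k t j = 1 := by
  rw [← Finset.add_sum_erase _ _ (Finset.mem_univ k)]
  have h : ∑ j ∈ Finset.univ.erase k, B.transProb i k t j
      = ∑ l ∈ Finset.univ.erase k, B.f i k t * B.q i k l :=
    Finset.sum_congr rfl fun j hj => by simp [transProb, Finset.ne_of_mem_erase hj]
  rw [h]
  simp [transProb]

/-- Law of the new state of arm `i` when it is played in state `k` after `t` steps. -/
def nextState (B : MonotoneBandit ι S) (i : ι) (k : S i) (t : ℕ+) : PMF (S i) :=
  PMF.ofFintype (fun j => ENNReal.ofReal (B.transProb i k t j)) (by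
    rw [← ENNReal.ofReal_sum_of_nonneg fun j _ => B.transProb_nonneg i k t j, B.transProb_sum,
      ENNReal.ofReal_one])

/-- All arms wait for one step. -/
def wait (c : Config S) : Config S := fun l => ((c l).1, (c l).2 + 1)

/-- Law of the next configuration: the played arm moves and its clock restarts at `1`; all other
arms keep their state and their clocks advance. -/
def step (B : MonotoneBandit ι S) (c : Config S) : Option ι → PMF (Config S)
  | none => PMF.pure (wait c)
  | some i => (B.nextState i (c i).1 (c i).2).map fun j => Function.update (wait c) i (j, 1)

/-- Reward of an action. -/
def reward (B : MonotoneBandit ι S) (c : Config S) : Option ι → ℝ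
  | none => 0
  | some i => B.r i (c i).1

/-- Law of (past, current configuration) after `T` steps of policy `π` started at `c₀`. -/
def law (B : MonotoneBandit ι S) (π : Policy S) (c₀ : Config S) :
    ℕ → PMF (History S × Config S)
  | 0 => PMF.pure ([], c₀)
  | T + 1 => (law B π c₀ T).bind fun ω => (π ω.1 ω.2).bind fun a =>
      (B.step ω.2 a).map fun c' => ((ω.2, a) :: ω.1, c')

/-- Expected reward of the step that follows the first `T` steps. -/
def expStepReward (B : MonotoneBandit ι S) (π : Policy S) (c₀ : Config S) (T : ℕ) : ℝ :=
  ∑' ω, (B.law π c₀ T ω).toReal * ∑ a, (π ω.1 ω.2 a).toReal * B.reward ω.2 a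

/-- Expected time-average reward `E[R_T] / T` of the first `T` steps, for start states `s`. -/
def avgReward (B : MonotoneBandit ι S) (π : Policy S) (s : ∀ i, S i) (T : ℕ) : ℝ :=
  (∑ u ∈ Finset.range T, B.expStepReward π (start s) u) / T

/-! ### Whittle's linear program -/

/-- Feasibility for Whittle's (infinite) linear program. -/
structure WhittleFeasible (B : MonotoneBandit ι S) (x : ∀ i, S i → ℕ+ → ℝ) : Prop where
  nonneg : ∀ i k t, 0 ≤ x i k t
  /-- The series in the constraint for arm `i` converge; all other series are then convergent. -/
  summable : ∀ i k, Summable fun t : ℕ+ => (t : ℝ) * x i k t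
  plays_le : ∑ i, ∑ k, ∑' t, x i k t ≤ 1
  time_le : ∀ i, ∑ k, ∑' t : ℕ+, (t : ℝ) * x i k t ≤ 1
  balance : ∀ i k,
    ∑ j ∈ Finset.univ.erase k, ∑' t, x i k t * B.q i k j * B.f i k t
      = ∑ j ∈ Finset.univ.erase k, ∑' t, x i j t * B.q i j k * B.f i j t

/-- The objective of Whittle's linear program. -/
def whittleObjective (B : MonotoneBandit ι S) (x : ∀ i, S i → ℕ+ → ℝ) : ℝ :=
  ∑ i, ∑ k, ∑' t, B.r i k * x i k t

/-- `OPT`, the optimal value of Whittle's linear program. -/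
def OPT (B : MonotoneBandit ι S) : ℝ :=
  sSup {v | ∃ x, B.WhittleFeasible x ∧ v = B.whittleObjective x}

/-- The supremum in `OPT` is over a non-empty set which is bounded above. -/
theorem OPT_isLUB (B : MonotoneBandit ι S) :
    IsLUB {v | ∃ x, B.WhittleFeasible x ∧ v = B.whittleObjective x} B.OPT := by
  apply isLUB_csSup
  · refine ⟨_, fun _ _ _ => 0, ⟨?_, ?_, ?_, ?_, ?_⟩, rfl⟩ <;> simp [summable_zero]
  · refine ⟨∑ i, ∑ k, B.r i k, ?_⟩
    rintro v ⟨x, hx, rfl⟩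
    have hle : ∀ i k (t : ℕ+), x i k t ≤ (t : ℝ) * x i k t := fun i k t => by
      have h1 : (1 : ℝ) ≤ (t : ℝ) := by exact_mod_cast t.pos
      nlinarith [hx.nonneg i k t]
    have hs : ∀ i k, Summable (x i k) := fun i k =>
      Summable.of_nonneg_of_le (hx.nonneg i k) (hle i k) (hx.summable i k)
    refine Finset.sum_le_sum fun i _ => Finset.sum_le_sum fun k _ => ?_
    rw [tsum_mul_left]
    have h0 : ∀ l, 0 ≤ ∑' t : ℕ+, (t : ℝ) * x i l t := fun l =>
      tsum_nonneg fun t => mul_nonneg (Nat.cast_nonneg _) (hx.nonneg i l t)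
    have h1 : ∑' t, x i k t ≤ 1 :=
      ((hs i k).tsum_le_tsum (hle i k) (hx.summable i k)).trans
        ((Finset.single_le_sum (f := fun l => ∑' t : ℕ+, (t : ℝ) * x i l t)
          (fun l _ => h0 l) (Finset.mem_univ k)).trans (hx.time_le i))
    exact mul_le_of_le_one_right (B.r_nonneg i k) h1

/-! ### The balanced linear program -/

/-- `ΔP^i_k`, the expected change of the dual potential on an escape from state `k`. -/
def deltaP (B : MonotoneBandit ι S) (D : BalanceVars ι S) (i : ι) (k : S i) : ℝ :=
  ∑ j ∈ Finset.univ.erase k, B.q i k j * (D.p i j - D.p i k)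

/-- Feasibility for (Balance). -/
structure BalanceFeasible (B : MonotoneBandit ι S) (D : BalanceVars ι S) : Prop where
  dual : ∀ i k, ∀ t ∈ B.W i k,
    B.r i k + B.f i k t * B.deltaP D i k ≤ D.lam + (t : ℝ) * D.h i
  balance : D.lam = ∑ i, D.h i
  lam_nonneg : 0 ≤ D.lam
  h_nonneg : ∀ i, 0 ≤ D.h i

/-- Optimality for (Balance): minimize `λ + ∑ i, h i`. -/
def BalanceOptimal (B : MonotoneBandit ι S) (D : BalanceVars ι S) : Prop :=
  B.BalanceFeasible D ∧
    ∀ D', B.BalanceFeasible D' → D.lam + ∑ i, D.h i ≤ D'.lam + ∑ i, D'.h i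

/-! ### The BalancedIndex policy -/

/-- The times in `W i k` at which the constraint of (Balance) is tight. -/
def tightTimes (B : MonotoneBandit ι S) (D : BalanceVars ι S) (i : ι) (k : S i) : Set ℕ+ :=
  {t | t ∈ B.W i k ∧ D.lam + (t : ℝ) * D.h i = B.r i k + B.f i k t * B.deltaP D i k}

/-- For every arm with `h i > 0`, every state has a tight constraint. -/
def AllTight (B : MonotoneBandit ι S) (D : BalanceVars ι S) : Prop :=
  ∀ i, 0 < D.h i → ∀ k, (B.tightTimes D i k).Nonempty

/-- Arm `i` is retained (`h i > 0`) and its current state is good, that is, in `G_i`. -/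
def Good (B : MonotoneBandit ι S) (D : BalanceVars ι S) (c : Config S) (i : ι) : Prop :=
  0 < D.h i ∧ B.deltaP D i (c i).1 < 0

/-- Arm `i` is retained, its current state `k` is in `I_i`, and it has waited for at least
`t^i_k` steps, where `t^i_k` is the smallest tight time. -/
def Ready (B : MonotoneBandit ι S) (D : BalanceVars ι S) (c : Config S) (i : ι) : Prop :=
  0 < D.h i ∧ 0 ≤ B.deltaP D i (c i).1 ∧
    ∃ t, IsLeast (B.tightTimes D i (c i).1) t ∧ t ≤ (c i).2

/-- The action of the most recent step (`none` at the start). -/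
def lastAction : History S → Option ι
  | [] => none
  | (_, a) :: _ => a

/-- The actions that the index rule allows in configuration `c` with past `past`: keep playing the
current arm while it is good; otherwise play a good arm, if there is one (only an arm that is in
its start state can be of this kind); otherwise play any ready arm; otherwise idle. -/
def IndexAction (B : MonotoneBandit ι S) (D : BalanceVars ι S) (past : History S) (c : Config S)
    (a : Option ι) : Prop :=
  (∃ i, lastAction past = some i ∧ B.Good D c i ∧ a = some i) ∨
  ((¬ ∃ i, lastAction past = some i ∧ B.Good D c i) ∧ ∃ i, B.Good D c i ∧ a = some i) ∨
  ((¬ ∃ i, B.Good D c i) ∧ ∃ i, B.Ready D c i ∧ a = some i) ∨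
  ((¬ ∃ i, B.Good D c i) ∧ (¬ ∃ i, B.Ready D c i) ∧ a = none)

/-- `π`, with start states `s`, is a BalancedIndex policy built from `D` (ties are broken in any
way).  If all retained arms have tight constraints in all states, it follows the index rule, from
any start states.  Otherwise it is the trivial policy that always plays one arm, started in a state
`j` which is never left and whose reward is `λ + h i`. -/
def IsBalancedIndex (B : MonotoneBandit ι S) (D : BalanceVars ι S) (s : ∀ i, S i)
    (π : Policy S) : Prop :=
  (B.AllTight D ∧ ∀ past c, ∀ a ∈ (π past c).support, B.IndexAction D past c a) ∨
  (¬ B.AllTight D ∧ ∃ i, 0 < D.h i ∧ B.f i (s i) 1 = 0 ∧ B.r i (s i) = D.lam + D.h i ∧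
    ∀ past c, π past c = PMF.pure (some i))

end MonotoneBandit

end

/-! With `λ = ∑ i, h i`, the dual value `λ + ∑ i, h i` equals `2λ`. So it suffices that `2λ` bounds
`OPT` and every policy from above, and that a BalancedIndex policy earns at least `λ` per step in
the long run.

Upper bounds: the dual constraint extends from breakpoints to all times (`dual_all`). Weighting it
with a Whittle-feasible `x` gives `OPT ≤ 2λ` (`OPT_le`). For policies, the potential `∑ l, (p l + h
l * clock)` converts the same constraint into a drift inequality, so no policy beats `2λ`
(`sum_expStepReward_le`); no strong duality is needed.

Lower bound: stop the clock of a retained arm at its smallest tight time. An idle step occurs only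
while every retained arm is still accruing, so the potential rises by at least `∑ l, h l = λ`.
Playing a ready arm releases the stored potential, and the tight constraint together with
monotonicity of `f` makes reward plus drift at least `λ`. In a good state the tight time is 1, so
immediate replay gives the same bound. A penalty `K` pays for good arms not played in the last step
(`indexPotential_drift`).

Optimality is needed only when some tight constraint is missing. Strong connectivity then lets the
potentials of that arm be perturbed until all its constraints are slack, and the objective could be
lowered, unless a state absorbing under continual play already pays `λ + h i` (`exists_absorbing`).
-/

/-! ### Attainment in linear programming -/

/-- From a feasible point one can move to a feasible point that is at least as good and at which
the objective is determined by the set of tight constraints. -/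
theorem exists_vertex_le {E J : Type*} [AddCommGroup E] [Module ℝ E] [Fintype J]
    (a : J → E →ₗ[ℝ] ℝ) (b : J → ℝ) (c : E →ₗ[ℝ] ℝ) (m : ℝ)
    (hm : ∀ x, (∀ j, b j ≤ a j x) → m ≤ c x) :
    ∀ (n : ℕ) (x : E), (∀ j, b j ≤ a j x) → {j | b j < a j x}.ncard ≤ n →
      ∃ y, (∀ j, b j ≤ a j y) ∧ c y ≤ c x ∧
        ∀ d, (∀ j, a j y = b j → a j d = 0) → c d = 0 := by
  intro n
  induction n with
  | zero =>
    intro x hx hn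
    refine ⟨x, hx, le_rfl, fun d hd => ?_⟩
    have htight : ∀ j, a j x = b j := fun j => by
      by_contra hj
      have hmem : j ∈ {j | b j < a j x} := lt_of_le_of_ne (hx j) (Ne.symm hj)
      have := (Set.ncard_pos (Set.toFinite _)).2 ⟨j, hmem⟩
      omega
    -- The whole line through `x` in direction `d` is feasible; if `c d ≠ 0`, the multiplier below
    -- brings the objective to `m - 1`, under its lower bound.
    have hfeas : ∀ s : ℝ, m ≤ c (x + s • d) := fun s =>
      hm _ fun j => by simp [hd j (htight j), hx j]
    by_contra hcd
    have h := hfeas (-(c x - m + 1) / c d)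
    simp only [map_add, map_smul, smul_eq_mul] at h
    rw [div_mul_cancel₀ _ hcd] at h
    linarith
  | succ n ih =>
    intro x hx hn
    by_cases hv : ∀ d, (∀ j, a j x = b j → a j d = 0) → c d = 0
    · exact ⟨x, hx, le_rfl, hv⟩
    obtain ⟨d, hd, hcd⟩ : ∃ d, (∀ j, a j x = b j → a j d = 0) ∧ c d < 0 := by
      push Not at hv
      obtain ⟨d, hd, hcd⟩ := hv
      rcases lt_or_gt_of_ne hcd with h | h
      · exact ⟨d, hd, h⟩
      · exact ⟨-d, fun j hj => by simp [hd j hj], by simpa using h⟩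
    -- `N` collects the constraints that get worse along the improving direction. If there were
    -- none, the ray would be feasible with unbounded objective.
    classical
    set N : Finset J := Finset.univ.filter fun j => a j d < 0 with hN
    have hNne : N.Nonempty := by
      by_contra hemp
      rw [Finset.not_nonempty_iff_eq_empty, Finset.filter_eq_empty_iff] at hemp
      have h := hm (x + (-(c x - m + 1) / c d) • d) fun j => by
        have h1 : 0 ≤ a j d := not_lt.1 (hemp (Finset.mem_univ j))
        have h2 := hm x hx
        have h3 : 0 ≤ -(c x - m + 1) / c d :=
          div_nonneg_of_nonpos (by linarith) hcd.le
        simp only [map_add, map_smul, smul_eq_mul]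
        have := mul_nonneg h3 h1
        linarith [hx j]
      simp only [map_add, map_smul, smul_eq_mul] at h
      rw [div_mul_cancel₀ _ hcd.ne] at h
      linarith
    -- Ratio test: `s` is the longest feasible step, and the blocking constraint `j₀` becomes tight
    -- while tight ones stay tight, so the number of slack constraints drops.
    obtain ⟨j₀, hj₀, hmin⟩ := N.exists_min_image (fun j => (a j x - b j) / (-a j d)) hNne
    have hneg : ∀ j ∈ N, a j d < 0 := fun j hj => (Finset.mem_filter.1 hj).2
    set s : ℝ := (a j₀ x - b j₀) / (-a j₀ d) with hs
    have hs0 : 0 ≤ s := div_nonneg (by linarith [hx j₀]) (by linarith [hneg j₀ hj₀])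
    have hfeas : ∀ j, b j ≤ a j (x + s • d) := fun j => by
      simp only [map_add, map_smul, smul_eq_mul]
      by_cases hj : j ∈ N
      · have h1 := hmin j hj
        rw [le_div_iff₀ (by linarith [hneg j hj])] at h1
        linarith
      · have h1 : 0 ≤ a j d := not_lt.1 fun h => hj (Finset.mem_filter.2 ⟨Finset.mem_univ j, h⟩)
        have := mul_nonneg hs0 h1
        linarith [hx j]
    have htight : a j₀ (x + s • d) = b j₀ := by
      have h1 : a j₀ d ≠ 0 := (hneg j₀ hj₀).ne
      simp only [map_add, map_smul, smul_eq_mul, hs]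
      field_simp
      ring
    have hslack : b j₀ < a j₀ x :=
      lt_of_le_of_ne (hx j₀) fun h => (hneg j₀ hj₀).ne (hd j₀ h.symm)
    have hsub : {j | b j < a j (x + s • d)} ⊂ {j | b j < a j x} := by
      refine (Set.ssubset_iff_of_subset fun j hj => ?_).2 ⟨j₀, hslack, fun h => ?_⟩
      · refine lt_of_le_of_ne (hx j) fun h => ?_
        have h1 : b j < a j (x + s • d) := hj
        simp [hd j h.symm, ← h] at h1
      · exact h.ne htight.symm
    have hcard := Set.ncard_lt_ncard hsub (Set.toFinite _)
    obtain ⟨y, hy, hyc, hyv⟩ := ih _ hfeas (by omega)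
    refine ⟨y, hy, hyc.trans ?_, hyv⟩
    simp only [map_add, map_smul, smul_eq_mul]
    nlinarith

/-- A linear function that is bounded below on a non-empty polyhedron attains its minimum. -/
theorem exists_forall_le_of_polyhedron {E J : Type*} [AddCommGroup E] [Module ℝ E] [Fintype J]
    (a : J → E →ₗ[ℝ] ℝ) (b : J → ℝ) (c : E →ₗ[ℝ] ℝ) (m : ℝ)
    (hm : ∀ x, (∀ j, b j ≤ a j x) → m ≤ c x) (hne : ∃ x, ∀ j, b j ≤ a j x) :
    ∃ x, (∀ j, b j ≤ a j x) ∧ ∀ y, (∀ j, b j ≤ a j y) → c x ≤ c y := by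
  set V : Set E := {y | (∀ j, b j ≤ a j y) ∧ ∀ d, (∀ j, a j y = b j → a j d = 0) → c d = 0}
  have hV : ∀ x, (∀ j, b j ≤ a j x) → ∃ y ∈ V, c y ≤ c x := fun x hx => by
    obtain ⟨y, hy, hyc, hyv⟩ := exists_vertex_le a b c m hm _ x hx le_rfl
    exact ⟨y, ⟨hy, hyv⟩, hyc⟩
  -- Two points of `V` with the same tight set differ by a direction that annihilates these
  -- constraints, hence have equal objective. So the values on `V` are indexed by sets of
  -- constraints; 0 is a dummy for sets that do not occur.
  have hfin : (c '' V).Finite := by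
    classical
    refine (Set.finite_range fun t : Set J =>
      if h : ∃ y ∈ V, {j | a j y = b j} = t then c h.choose else 0).subset ?_
    rintro _ ⟨y, hy, rfl⟩
    have h : ∃ z ∈ V, {j | a j z = b j} = {j | a j y = b j} := ⟨y, hy, rfl⟩
    refine ⟨{j | a j y = b j}, ?_⟩
    simp only [dif_pos h]
    obtain ⟨hz, hzy⟩ := h.choose_spec
    rw [← sub_eq_zero, ← map_sub]
    refine hz.2 _ fun j hj => ?_
    have hyj : a j y = b j := (Set.ext_iff.1 hzy j).1 hj
    rw [map_sub, hj, hyj, sub_self]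
  obtain ⟨x, hx⟩ := hne
  obtain ⟨y, hyV, -⟩ := hV x hx
  obtain ⟨v, ⟨z, hzV, rfl⟩, hv⟩ := Set.exists_min_image (c '' V) id hfin ⟨_, y, hyV, rfl⟩
  refine ⟨z, hzV.1, fun w hw => ?_⟩
  obtain ⟨w', hw', hle⟩ := hV w hw
  exact (hv _ ⟨w', hw', rfl⟩).trans hle

/-! ### Expectations of bounded functions under a discrete law -/

namespace PMF

variable {α β : Type*}

/-- Expectation of a real function under a discrete law. -/
noncomputable def expect (p : PMF α) (g : α → ℝ) : ℝ := ∑' a, (p a).toReal * g a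

theorem summable_toReal (p : PMF α) : Summable fun a => (p a).toReal :=
  ENNReal.summable_toReal p.tsum_coe_ne_top

theorem tsum_toReal (p : PMF α) : ∑' a, (p a).toReal = 1 := by
  rw [← ENNReal.tsum_toReal_eq fun a => p.apply_ne_top a, p.tsum_coe, ENNReal.toReal_one]

theorem summable_expect (p : PMF α) {g : α → ℝ} {C : ℝ} (hg : ∀ a, |g a| ≤ C) :
    Summable fun a => (p a).toReal * g a := by
  refine Summable.of_norm_bounded (p.summable_toReal.mul_right C) fun a => ?_
  rw [Real.norm_eq_abs, abs_mul, abs_of_nonneg ENNReal.toReal_nonneg]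
  exact mul_le_mul_of_nonneg_left (hg a) ENNReal.toReal_nonneg

theorem expect_const (p : PMF α) (x : ℝ) : p.expect (fun _ => x) = x := by
  rw [expect, tsum_mul_right, tsum_toReal, one_mul]

theorem expect_mono (p : PMF α) {g g' : α → ℝ} {C C' : ℝ} (hg : ∀ a, |g a| ≤ C)
    (hg' : ∀ a, |g' a| ≤ C') (h : ∀ a ∈ p.support, g a ≤ g' a) : p.expect g ≤ p.expect g' := by
  refine (p.summable_expect hg).tsum_le_tsum (fun a => ?_) (p.summable_expect hg')
  by_cases ha : a ∈ p.support
  · exact mul_le_mul_of_nonneg_left (h a ha) ENNReal.toReal_nonneg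
  · simp [(p.apply_eq_zero_iff a).2 ha]

theorem expect_add (p : PMF α) {g g' : α → ℝ} {C C' : ℝ} (hg : ∀ a, |g a| ≤ C)
    (hg' : ∀ a, |g' a| ≤ C') : p.expect (fun a => g a + g' a) = p.expect g + p.expect g' := by
  simp only [expect, mul_add]
  exact (p.summable_expect hg).tsum_add (p.summable_expect hg')

theorem expect_const_mul (p : PMF α) (x : ℝ) (g : α → ℝ) :
    p.expect (fun a => x * g a) = x * p.expect g := by
  simp only [expect, mul_left_comm _ x, tsum_mul_left]

theorem abs_expect_le (p : PMF α) {g : α → ℝ} {C : ℝ} (hg : ∀ a, |g a| ≤ C) :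
    |p.expect g| ≤ C := by
  have hC : ∀ a, |C| ≤ |C| := fun _ : α => le_rfl
  rw [abs_le]
  constructor
  · rw [← p.expect_const (-C)]
    exact p.expect_mono (C := |C|) (fun _ => (abs_neg C).le) hg fun a _ => (abs_le.1 (hg a)).1
  · rw [← p.expect_const C]
    exact p.expect_mono hg hC fun a _ => (abs_le.1 (hg a)).2

theorem expect_pure (a : α) (g : α → ℝ) : (PMF.pure a).expect g = g a := by
  rw [expect, tsum_eq_single a fun b hb => by simp [PMF.pure_apply, hb]]
  simp

theorem expect_bind (p : PMF α) (q : α → PMF β) {g : β → ℝ} {C : ℝ} (hg : ∀ b, |g b| ≤ C) :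
    (p.bind q).expect g = p.expect fun a => (q a).expect g := by
  have hs : Summable fun x : α × β => (p x.1).toReal * ((q x.1 x.2).toReal * g x.2) := by
    have h2 : Summable fun x : α × β => (p x.1).toReal * (q x.1 x.2).toReal := by
      have h0 : ∀ x : α × β, 0 ≤ (p x.1).toReal * (q x.1 x.2).toReal := fun _ =>
        mul_nonneg ENNReal.toReal_nonneg ENNReal.toReal_nonneg
      have h1 : ∀ a, Summable fun b => (p a).toReal * (q a b).toReal := fun a =>
        (q a).summable_toReal.mul_left (p a).toReal
      refine (summable_prod_of_nonneg h0).2 ⟨h1, ?_⟩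
      simp only [tsum_mul_left, tsum_toReal, mul_one]
      exact p.summable_toReal
    refine Summable.of_norm_bounded (h2.mul_right C) fun x => ?_
    rw [Real.norm_eq_abs, abs_mul, abs_mul, abs_of_nonneg ENNReal.toReal_nonneg,
      abs_of_nonneg ENNReal.toReal_nonneg, mul_assoc]
    exact mul_le_mul_of_nonneg_left (mul_le_mul_of_nonneg_left (hg x.2) ENNReal.toReal_nonneg)
      ENNReal.toReal_nonneg
  have hbind : ∀ b, ((p.bind q) b).toReal = ∑' a, (p a).toReal * (q a b).toReal := fun b => by
    rw [PMF.bind_apply, ENNReal.tsum_toReal_eq fun a =>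
      ENNReal.mul_ne_top (p.apply_ne_top a) ((q a).apply_ne_top b)]
    simp only [ENNReal.toReal_mul]
  simp only [expect, hbind, ← tsum_mul_right, ← tsum_mul_left, mul_assoc]
  exact Summable.tsum_comm hs

theorem expect_map (p : PMF α) (u : α → β) {g : β → ℝ} {C : ℝ} (hg : ∀ b, |g b| ≤ C) :
    (p.map u).expect g = p.expect fun a => g (u a) := by
  rw [PMF.map, expect_bind p _ hg]
  simp only [Function.comp_apply, expect_pure]

end PMF

noncomputable section

namespace MonotoneBandit

variable {ι : Type*} {S : ι → Type*} [Fintype ι] [DecidableEq ι]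
  [∀ i, Fintype (S i)] [∀ i, DecidableEq (S i)]

/-! ### Existence of an optimal solution of (Balance) -/

/-- The left minus the variable part of the right hand side of a dual constraint, as a linear
function of `(h, p)` with `λ = ∑ i, h i`. -/
def dualForm (B : MonotoneBandit ι S) (i : ι) (k : S i) (t : ℕ+) :
    ((ι → ℝ) × (∀ i, S i → ℝ)) →ₗ[ℝ] ℝ where
  toFun x := ∑ l, x.1 l + (t : ℝ) * x.1 i
    - B.f i k t * ∑ j ∈ Finset.univ.erase k, B.q i k j * (x.2 i j - x.2 i k)
  map_add' x y := by
    have h : ∀ j, B.q i k j * ((x + y).2 i j - (x + y).2 i k)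
        = B.q i k j * (x.2 i j - x.2 i k) + B.q i k j * (y.2 i j - y.2 i k) := fun j => by
      simp only [Prod.snd_add, Pi.add_apply]; ring
    simp only [h, Finset.sum_add_distrib, Prod.fst_add, Pi.add_apply]
    ring
  map_smul' c x := by
    have h : ∀ j, B.q i k j * ((c • x).2 i j - (c • x).2 i k)
        = c * (B.q i k j * (x.2 i j - x.2 i k)) := fun j => by
      simp only [Prod.smul_snd, Pi.smul_apply, smul_eq_mul]; ring
    simp only [h, ← Finset.mul_sum, Prod.smul_fst, Pi.smul_apply, smul_eq_mul, RingHom.id_apply]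
    ring

/-- Substituting `λ = ∑ i, h i` removes the equality constraint and makes `λ ≥ 0` automatic. What
remains is to minimize `∑ i, h i`, half the objective, over a polyhedron on which it is nonnegative.
-/
theorem exists_balanceOptimal (B : MonotoneBandit ι S) :
    ∃ D : BalanceVars ι S, B.BalanceOptimal D := by
  let E := (ι → ℝ) × (∀ i, S i → ℝ)
  let J := (Σ i, Σ k : S i, {t // t ∈ B.W i k}) ⊕ ι
  let a : J → E →ₗ[ℝ] ℝ := Sum.elim (fun x => B.dualForm x.1 x.2.1 x.2.2.1)
    fun i => LinearMap.proj i ∘ₗ LinearMap.fst ℝ _ _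
  let b : J → ℝ := Sum.elim (fun x => B.r x.1 x.2.1) fun _ => 0
  let c : E →ₗ[ℝ] ℝ := (∑ i, LinearMap.proj i) ∘ₗ LinearMap.fst ℝ _ _
  have hc : ∀ x : E, c x = ∑ i, x.1 i := fun x => by simp [c]; rfl
  let toD : E → BalanceVars ι S := fun x => ⟨∑ i, x.1 i, x.1, x.2⟩
  have hfeas : ∀ x : E, (∀ j, b j ≤ a j x) ↔ B.BalanceFeasible (toD x) := fun x => by
    have hdual : ∀ i k (t : ℕ+), B.dualForm i k t x
        = ∑ l, x.1 l + (t : ℝ) * x.1 i - B.f i k t * B.deltaP (toD x) i k := fun _ _ _ => rfl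
    constructor
    · intro hx
      have hh : ∀ i, 0 ≤ x.1 i := fun i => hx (Sum.inr i)
      refine ⟨fun i k t ht => ?_, rfl, Finset.sum_nonneg fun i _ => hh i, hh⟩
      have h1 : B.r i k ≤ B.dualForm i k t x := hx (Sum.inl ⟨i, k, t, ht⟩)
      rw [hdual] at h1
      show B.r i k + _ ≤ ∑ l, x.1 l + (t : ℝ) * x.1 i
      linarith
    · rintro hD (⟨i, k, t, ht⟩ | i)
      · show B.r i k ≤ B.dualForm i k t x
        rw [hdual]
        have h1 : _ ≤ ∑ l, x.1 l + (t : ℝ) * x.1 i := hD.dual i k t ht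
        linarith
      · exact hD.h_nonneg i
  obtain ⟨x, hx, hmin⟩ := exists_forall_le_of_polyhedron a b c 0
    (fun x hx => by
      rw [hc]
      exact Finset.sum_nonneg fun i _ => ((hfeas x).1 hx).h_nonneg i)
    -- With zero potentials, `h i` alone covers every reward of arm `i`, since `t ≥ 1`.
    ⟨(fun i => ∑ k, B.r i k, fun _ _ => 0), by
      have hr : ∀ i, 0 ≤ ∑ k, B.r i k := fun i => Finset.sum_nonneg fun k _ => B.r_nonneg i k
      rw [hfeas]
      refine ⟨fun i k t _ => ?_, rfl, Finset.sum_nonneg fun i _ => hr i, hr⟩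
      have h1 : B.r i k ≤ ∑ k, B.r i k :=
        Finset.single_le_sum (fun k _ => B.r_nonneg i k) (Finset.mem_univ k)
      have h2 : 0 ≤ ∑ i, ∑ k, B.r i k := Finset.sum_nonneg fun i _ => hr i
      have h3 : (1 : ℝ) ≤ (t : ℝ) := by exact_mod_cast t.pos
      simp only [deltaP, toD, sub_zero, mul_zero, Finset.sum_const_zero, add_zero]
      nlinarith [hr i]⟩
  refine ⟨toD x, (hfeas x).1 hx, fun D' hD' => ?_⟩
  have hD'' : toD (D'.h, D'.p) = D' := by
    cases D' with
    | mk l h p => simp only [toD, BalanceVars.mk.injEq, and_true]; exact hD'.balance.symm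
  have h1 := hmin (D'.h, D'.p) ((hfeas _).2 (by rwa [hD'']))
  rw [hc, hc] at h1
  rw [hD'.balance]
  show ∑ i, x.1 i + ∑ i, x.1 i ≤ _
  linarith

/-! ### The dual constraint at all times -/

theorem f_monotone (B : MonotoneBandit ι S) (i : ι) (k : S i) : Monotone (B.f i k) := by
  intro s t hst
  induction t using PNat.recOn with
  | one => rw [le_antisymm hst one_le]
  | succ t ih =>
    rcases hst.eq_or_lt with rfl | h
    · exact le_rfl
    · exact (ih (PNat.lt_add_one_iff.1 h)).trans (B.f_mono i k t)

/-- By piecewise linearity the dual constraint extends from breakpoints to all times. -/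
theorem BalanceFeasible.dual_all {B : MonotoneBandit ι S} {D : BalanceVars ι S}
    (hD : B.BalanceFeasible D) (i : ι) (k : S i) (t : ℕ+) :
    B.r i k + B.f i k t * B.deltaP D i k ≤ D.lam + (t : ℝ) * D.h i := by
  have hne : ((B.W i k).filter (· ≤ t)).Nonempty :=
    ⟨1, Finset.mem_filter.2 ⟨B.one_mem_W i k, one_le⟩⟩
  obtain ⟨t₁, ht₁, hmax⟩ := Finset.exists_max_image _ id hne
  obtain ⟨hW₁, hle₁⟩ := Finset.mem_filter.1 ht₁
  have hd₁ := hD.dual i k t₁ hW₁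
  rcases hle₁.eq_or_lt with rfl | hlt₁
  · exact hd₁
  by_cases hne₂ : ((B.W i k).filter (t < ·)).Nonempty
  · obtain ⟨t₂, ht₂, hmin⟩ := Finset.exists_min_image _ id hne₂
    obtain ⟨hW₂, hlt₂⟩ := Finset.mem_filter.1 ht₂
    have hd₂ := hD.dual i k t₂ hW₂
    rw [B.f_interp i k t₁ hW₁ t₂ hW₂ (hlt₁.trans hlt₂) (fun u hu => by
      rcases le_or_gt u t with h | h
      · exact Or.inl (hmax u (Finset.mem_filter.2 ⟨hu, h⟩))
      · exact Or.inr (hmin u (Finset.mem_filter.2 ⟨hu, h⟩))) t hlt₁ hlt₂]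
    have h1 : (t₁ : ℝ) < t := by exact_mod_cast hlt₁
    have h2 : (t : ℝ) < t₂ := by exact_mod_cast hlt₂
    have h3 : (0 : ℝ) < (t₂ : ℝ) - t₁ := by linarith
    -- Between breakpoints both sides are affine in `t`, so the constraint is a convex combination
    -- of those at `t₁` and `t₂`.
    rw [div_mul_eq_mul_div, ← le_sub_iff_add_le', div_le_iff₀ h3]
    have e1 := mul_le_mul_of_nonneg_left hd₁ (sub_nonneg.2 h2.le)
    have e2 := mul_le_mul_of_nonneg_left hd₂ (sub_nonneg.2 h1.le)
    linarith
  · rw [B.f_tail i k t₁ hW₁ (fun u hu => by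
      rcases le_or_gt u t with h | h
      · exact hmax u (Finset.mem_filter.2 ⟨hu, h⟩)
      · exact absurd ⟨u, Finset.mem_filter.2 ⟨hu, h⟩⟩ hne₂) t hle₁]
    have h1 : (t₁ : ℝ) < t := by exact_mod_cast hlt₁
    have := mul_le_mul_of_nonneg_right h1.le (hD.h_nonneg i)
    linarith

/-! ### Weak duality -/

/-- Weak duality: weight the dual constraints with `x` and sum. The escape rates `y i k` form a
circulation, so the potential terms cancel. -/
theorem WhittleFeasible.objective_le {B : MonotoneBandit ι S} {x : ∀ i, S i → ℕ+ → ℝ}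
    (hx : B.WhittleFeasible x) {D : BalanceVars ι S} (hD : B.BalanceFeasible D) :
    B.whittleObjective x ≤ D.lam + ∑ i, D.h i := by
  have hle : ∀ i k (t : ℕ+), x i k t ≤ (t : ℝ) * x i k t := fun i k t => by
    have h1 : (1 : ℝ) ≤ (t : ℝ) := by exact_mod_cast t.pos
    nlinarith [hx.nonneg i k t]
  have hs : ∀ i k, Summable (x i k) := fun i k =>
    Summable.of_nonneg_of_le (hx.nonneg i k) (hle i k) (hx.summable i k)
  have hsf : ∀ i k, Summable fun t => x i k t * B.f i k t := fun i k =>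
    Summable.of_nonneg_of_le (fun t => mul_nonneg (hx.nonneg i k t) (B.f_nonneg i k t))
      (fun t => mul_le_of_le_one_right (hx.nonneg i k t) (B.f_le_one i k t)) (hs i k)
  set y : ∀ i, S i → ℝ := fun i k => ∑' t, x i k t * B.f i k t with hy
  have hbal : ∀ i k, ∑ j ∈ Finset.univ.erase k, y i k * B.q i k j
      = ∑ j ∈ Finset.univ.erase k, y i j * B.q i j k := fun i k => by
    have h := hx.balance i k
    have e : ∀ j l m, ∑' t, x i j t * B.q i l m * B.f i j t = y i j * B.q i l m :=
      fun j l m => by rw [hy, ← tsum_mul_right]; exact tsum_congr fun t => by ring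
    simpa only [e] using h
  have hzero : ∀ i, ∑ k, y i k * B.deltaP D i k = 0 := fun i => by
    -- Sums can run over all `j`, whatever the diagonal of `q` is, because the term `j = k` cancels
    -- in the difference.
    have e1 : ∀ k, y i k * B.deltaP D i k
        = ∑ j, y i k * B.q i k j * D.p i j - ∑ j, y i k * B.q i k j * D.p i k := fun k => by
      rw [deltaP, Finset.mul_sum, ← Finset.sum_sub_distrib,
        ← Finset.sum_erase_add _ _ (Finset.mem_univ k), sub_self, add_zero]
      exact Finset.sum_congr rfl fun j _ => by ring
    have e2 : ∀ k, ∑ j, y i k * B.q i k j = ∑ j, y i j * B.q i j k := fun k => by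
      rw [← Finset.sum_erase_add _ _ (Finset.mem_univ k), hbal i k,
        ← Finset.sum_erase_add (a := k) Finset.univ (fun j => y i j * B.q i j k)
          (Finset.mem_univ k)]
    simp only [e1, Finset.sum_sub_distrib]
    rw [Finset.sum_comm, sub_eq_zero]
    refine Finset.sum_congr rfl fun k _ => ?_
    rw [← Finset.sum_mul, ← Finset.sum_mul, e2]
  have hterm : ∀ i k, ∑' t, B.r i k * x i k t
      ≤ D.lam * ∑' t, x i k t + D.h i * ∑' t : ℕ+, (t : ℝ) * x i k t
        - y i k * B.deltaP D i k := fun i k => by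
    have h1 := (((hs i k).hasSum.mul_left D.lam).add
      ((hx.summable i k).hasSum.mul_left (D.h i))).sub
      ((hsf i k).hasSum.mul_right (B.deltaP D i k))
    refine hasSum_le (fun t => ?_) ((hs i k).mul_left (B.r i k)).hasSum h1
    have := mul_le_mul_of_nonneg_right (hD.dual_all i k t) (hx.nonneg i k t)
    linarith
  calc B.whittleObjective x
      ≤ ∑ i, ∑ k, (D.lam * ∑' t, x i k t + D.h i * ∑' t : ℕ+, (t : ℝ) * x i k t
        - y i k * B.deltaP D i k) :=
        Finset.sum_le_sum fun i _ => Finset.sum_le_sum fun k _ => hterm i k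
    _ = D.lam * ∑ i, ∑ k, ∑' t, x i k t
        + ∑ i, D.h i * ∑ k, ∑' t : ℕ+, (t : ℝ) * x i k t := by
        simp only [Finset.sum_sub_distrib, Finset.sum_add_distrib, hzero, Finset.mul_sum, sub_zero]
    _ ≤ D.lam * 1 + ∑ i, D.h i * 1 := by
        refine add_le_add (mul_le_mul_of_nonneg_left hx.plays_le hD.lam_nonneg)
          (Finset.sum_le_sum fun i _ =>
            mul_le_mul_of_nonneg_left (hx.time_le i) (hD.h_nonneg i))
    _ = D.lam + ∑ i, D.h i := by simp only [mul_one]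

theorem BalanceFeasible.OPT_le {B : MonotoneBandit ι S} {D : BalanceVars ι S}
    (hD : B.BalanceFeasible D) : B.OPT ≤ D.lam + ∑ i, D.h i := by
  refine B.OPT_isLUB.2 ?_
  rintro _ ⟨x, hx, rfl⟩
  exact hx.objective_le hD

/-! ### Existence of a BalancedIndex policy -/

/-- A level function that decreases along some edge out of every state other than `k`. -/
theorem exists_level (B : MonotoneBandit ι S) (i : ι) (k : S i) :
    ∃ d : S i → ℕ, ∀ j, j ≠ k → ∃ l, 0 < B.q i j l ∧ d l < d j := by
  classical
  -- `P n j` says that `k` can be reached from `j` along `n` edges; the level is the distance to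
  -- `k`.
  obtain ⟨P, hP0, hPs⟩ : ∃ P : ℕ → S i → Prop, (∀ j, P 0 j ↔ j = k) ∧
      ∀ n j, P (n + 1) j ↔ ∃ l, 0 < B.q i j l ∧ P n l :=
    ⟨fun n => Nat.rec (fun j => j = k) (fun _ Q j => ∃ l, 0 < B.q i j l ∧ Q l) n,
      fun _ => Iff.rfl, fun _ _ => Iff.rfl⟩
  have hP : ∀ j, ∃ n, P n j := fun j => by
    induction B.connected i j k using Relation.ReflTransGen.head_induction_on with
    | refl => exact ⟨0, (hP0 k).2 rfl⟩
    | head hal _ ih =>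
      obtain ⟨n, hn⟩ := ih
      exact ⟨n + 1, (hPs n _).2 ⟨_, hal, hn⟩⟩
  refine ⟨fun j => Nat.find (hP j), fun j hj => ?_⟩
  have hspec := Nat.find_spec (hP j)
  cases hn : Nat.find (hP j) with
  | zero => rw [hn, hP0] at hspec; exact absurd hspec hj
  | succ n =>
    rw [hn, hPs] at hspec
    obtain ⟨l, hl, hPl⟩ := hspec
    refine ⟨l, hl, ?_⟩
    dsimp only
    rw [hn]
    exact Nat.lt_succ_of_le (Nat.find_min' _ hPl)

/-- A potential with negative drift in all states except `k`. -/
theorem exists_drift_neg (B : MonotoneBandit ι S) (i : ι) (k : S i) :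
    ∃ δ : S i → ℝ, ∀ j, j ≠ k →
      ∑ l ∈ Finset.univ.erase j, B.q i j l * (δ l - δ j) < 0 := by
  obtain ⟨d, hd⟩ := B.exists_level i k
  obtain ⟨ε, ⟨hε0, hε1⟩, hε⟩ : ∃ ε : ℝ, (0 < ε ∧ ε < 1) ∧
      ∀ j l, 0 < B.q i j l → ε < B.q i j l := by
    have h1 : ∀ᶠ ε : ℝ in nhdsWithin 0 (Set.Ioi 0), ∀ j l, 0 < B.q i j l → ε < B.q i j l := by
      refine eventually_all.2 fun j => eventually_all.2 fun l => ?_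
      by_cases h : 0 < B.q i j l
      · filter_upwards [mem_nhdsWithin_of_mem_nhds (Iio_mem_nhds h)] with _ hε _ using hε
      · exact Eventually.of_forall fun _ h' => absurd h' h
    have h0 : ∀ᶠ ε : ℝ in nhdsWithin 0 (Set.Ioi 0), ε ∈ Set.Ioo (0 : ℝ) 1 :=
      Ioo_mem_nhdsGT zero_lt_one
    obtain ⟨ε, h2, h3⟩ := (h0.and h1).exists
    exact ⟨ε, h2, h3⟩
  -- As `ε` is below every positive `q`, the gain `q * ε ^ d m` from the edge to a lower level `m`
  -- exceeds `ε ^ d j`, which bounds all losses together.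
  refine ⟨fun j => -ε ^ d j, fun j hj => ?_⟩
  obtain ⟨m, hqm, hdm⟩ := hd j hj
  have hmj : m ∈ Finset.univ.erase j :=
    Finset.mem_erase.2 ⟨fun h => by rw [h] at hdm; exact lt_irrefl _ hdm, Finset.mem_univ m⟩
  have hpow : ∀ n, 0 < ε ^ n := fun n => pow_pos hε0 n
  have h1 : ∑ l ∈ Finset.univ.erase j, B.q i j l * ε ^ d j ≤ ε ^ d j := by
    rw [← Finset.sum_mul]
    exact mul_le_of_le_one_left (hpow _).le (B.q_sum_le_one i j)
  have h2 : B.q i j m * ε ^ d m ≤ ∑ l ∈ Finset.univ.erase j, B.q i j l * ε ^ d l :=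
    Finset.single_le_sum (f := fun l => B.q i j l * ε ^ d l)
      (fun l _ => mul_nonneg (B.q_nonneg i j l) (hpow _).le) hmj
  have h3 : ε ^ d j ≤ ε ^ d m * ε := by
    rw [← pow_succ]
    exact pow_le_pow_of_le_one hε0.le hε1.le hdm
  have h4 := mul_lt_mul_of_pos_left (hε j m hqm) (hpow (d m))
  have h5 : ∑ l ∈ Finset.univ.erase j, B.q i j l * (-ε ^ d l - -ε ^ d j)
      = ∑ l ∈ Finset.univ.erase j, B.q i j l * ε ^ d j
        - ∑ l ∈ Finset.univ.erase j, B.q i j l * ε ^ d l := by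
    rw [← Finset.sum_sub_distrib]
    exact Finset.sum_congr rfl fun l _ => by ring
  rw [h5]
  linarith

/-- If some state of a retained arm has no tight constraint and no state is absorbing with reward
`λ + h i`, then the potentials of the arm can be changed so that none of its constraints is
tight. -/
theorem BalanceFeasible.exists_slack {B : MonotoneBandit ι S} {D : BalanceVars ι S}
    (hD : B.BalanceFeasible D) {i : ι} (hi : 0 < D.h i) {k : S i}
    (hk : ¬ (B.tightTimes D i k).Nonempty)
    (habs : ¬ ∃ j, B.f i j 1 = 0 ∧ B.r i j = D.lam + D.h i) :
    ∃ p : S i → ℝ, ∀ j, ∀ t ∈ B.W i j,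
      B.r i j + B.f i j t * ∑ l ∈ Finset.univ.erase j, B.q i j l * (p l - p j)
        < D.lam + (t : ℝ) * D.h i := by
  obtain ⟨δ, hδ⟩ := B.exists_drift_neg i k
  have hlin : ∀ (η : ℝ) j, ∑ l ∈ Finset.univ.erase j,
      B.q i j l * ((D.p i l + η * δ l) - (D.p i j + η * δ j)) = B.deltaP D i j
        + η * ∑ l ∈ Finset.univ.erase j, B.q i j l * (δ l - δ j) := fun η j => by
    rw [deltaP, Finset.mul_sum, ← Finset.sum_add_distrib]
    exact Finset.sum_congr rfl fun l _ => by ring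
  have hev : ∀ᶠ η : ℝ in nhdsWithin 0 (Set.Ioi 0), ∀ j, ∀ t ∈ B.W i j,
      B.r i j + B.f i j t * (B.deltaP D i j
        + η * ∑ l ∈ Finset.univ.erase j, B.q i j l * (δ l - δ j))
        < D.lam + (t : ℝ) * D.h i := by
    refine eventually_all.2 fun j => (Finset.eventually_all _).2 fun t ht => ?_
    rcases (hD.dual i j t ht).lt_or_eq with hlt | heq
    · refine mem_nhdsWithin_of_mem_nhds (ContinuousAt.eventually_lt (by fun_prop)
        continuousAt_const ?_)
      simpa using hlt
    · have hjk : j ≠ k := by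
        rintro rfl
        exact hk ⟨t, ht, heq.symm⟩
      -- If `f` vanished at a tight time `t`, then also at 1, and `r ≤ λ + h ≤ λ + t * h = r` would
      -- make `j` an excluded absorbing state.
      have hf : 0 < B.f i j t := by
        refine lt_of_le_of_ne (B.f_nonneg i j t) fun h0 => habs ⟨j, ?_, ?_⟩
        · exact le_antisymm (h0 ▸ B.f_monotone i j one_le) (B.f_nonneg i j 1)
        · have hf1 : B.f i j 1 = 0 :=
            le_antisymm (h0 ▸ B.f_monotone i j one_le) (B.f_nonneg i j 1)
          have h1 := hD.dual i j 1 (B.one_mem_W i j)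
          have h2 : (1 : ℝ) ≤ t := by exact_mod_cast t.pos
          have h3 := mul_le_mul_of_nonneg_right h2 hi.le
          rw [hf1, zero_mul, add_zero, PNat.one_coe, Nat.cast_one] at h1
          rw [← h0, zero_mul, add_zero] at heq
          linarith
      filter_upwards [self_mem_nhdsWithin] with η hη
      have := mul_pos hf (mul_pos hη (neg_pos.2 (hδ j hjk)))
      rw [mul_add, ← add_assoc, heq]
      linarith
  obtain ⟨η, hη⟩ := hev.exists
  exact ⟨fun j => D.p i j + η * δ j, fun j t ht => by rw [hlin]; exact hη j t ht⟩

/-- If no constraint of a retained arm is tight (after changing its potentials), then the solution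
is not optimal. -/
theorem BalanceFeasible.exists_lt_of_slack {B : MonotoneBandit ι S} {D : BalanceVars ι S}
    (hD : B.BalanceFeasible D) {i : ι} (hi : 0 < D.h i) {p : S i → ℝ}
    (hp : ∀ j, ∀ t ∈ B.W i j,
      B.r i j + B.f i j t * ∑ l ∈ Finset.univ.erase j, B.q i j l * (p l - p j)
        < D.lam + (t : ℝ) * D.h i) :
    ∃ D', B.BalanceFeasible D' ∧ D'.lam + ∑ l, D'.h l < D.lam + ∑ l, D.h l := by
  set n : ℝ := (Fintype.card ι : ℝ) with hn
  have hev : ∀ᶠ ε : ℝ in nhdsWithin 0 (Set.Ioi 0), (∀ j, ∀ t ∈ B.W i j,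
      B.r i j + B.f i j t * ∑ l ∈ Finset.univ.erase j, B.q i j l * (p l - p j)
        < D.lam - ε + (t : ℝ) * (D.h i - n * ε)) ∧ 0 < D.h i - n * ε := by
    refine Eventually.and (eventually_all.2 fun j => (Finset.eventually_all _).2 fun t ht => ?_) ?_
    · refine mem_nhdsWithin_of_mem_nhds (ContinuousAt.eventually_lt continuousAt_const
        (by fun_prop) ?_)
      simpa using hp j t ht
    · refine mem_nhdsWithin_of_mem_nhds (ContinuousAt.eventually_lt continuousAt_const
        (by fun_prop) ?_)
      simpa using hi
  obtain ⟨ε, ⟨hdual, hpos⟩, hε⟩ := (hev.and self_mem_nhdsWithin).exists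
  have hε0 : 0 < ε := hε
  -- Lowering `λ` by `ε` is compensated in the other arms by raising `h l` by `ε`, since `t ≥ 1`.
  -- The slack arm `i` gives up `n * ε`, which restores `λ = ∑ l, h l`.
  let h' : ι → ℝ := fun l => D.h l + ε - if l = i then (n + 1) * ε else 0
  have hsum : ∑ l, h' l = D.lam - ε := by
    simp only [h', Finset.sum_sub_distrib, Finset.sum_add_distrib, Finset.sum_ite_eq',
      Finset.mem_univ, if_true, Finset.sum_const, Finset.card_univ, nsmul_eq_mul, ← hn,
      ← hD.balance]
    ring
  have hi' : h' i = D.h i - n * ε := by simp only [h', if_true]; ring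
  have hl' : ∀ l, l ≠ i → h' l = D.h l + ε := fun l hl => by simp [h', hl]
  have hnonneg : ∀ l, 0 ≤ h' l := fun l => by
    by_cases hl : l = i
    · subst hl; rw [hi']; exact hpos.le
    · rw [hl' l hl]; linarith [hD.h_nonneg l]
  refine ⟨⟨D.lam - ε, h', Function.update D.p i p⟩, ⟨fun l k t ht => ?_, hsum.symm, ?_, hnonneg⟩,
    ?_⟩
  · by_cases hl : l = i
    · subst hl
      simp only [deltaP, Function.update_self, hi']
      exact (hdual k t ht).le
    · have h1 := hD.dual l k t ht
      have h2 : (1 : ℝ) ≤ t := by exact_mod_cast t.pos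
      have h3 := mul_le_mul_of_nonneg_right h2 hε0.le
      simp only [deltaP, Function.update_of_ne hl, hl' l hl]
      simp only [deltaP] at h1
      linarith
  · exact hsum ▸ Finset.sum_nonneg fun l _ => hnonneg l
  · rw [hsum, ← hD.balance]
    linarith

/-- Either all states of the retained arms have tight constraints, or a retained arm has an
absorbing state with reward `λ + h i`. -/
theorem BalanceOptimal.exists_absorbing {B : MonotoneBandit ι S} {D : BalanceVars ι S}
    (hD : B.BalanceOptimal D) (h : ¬ B.AllTight D) :
    ∃ i, 0 < D.h i ∧ ∃ j, B.f i j 1 = 0 ∧ B.r i j = D.lam + D.h i := by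
  unfold AllTight at h
  push Not at h
  obtain ⟨i, hi, k, hk⟩ := h
  refine ⟨i, hi, ?_⟩
  by_contra habs
  obtain ⟨p, hp⟩ := hD.1.exists_slack hi (Set.not_nonempty_iff_eq_empty.2 hk) habs
  obtain ⟨D', hD', hlt⟩ := hD.1.exists_lt_of_slack hi hp
  exact (hD.2 D' hD').not_gt hlt

theorem exists_indexAction (B : MonotoneBandit ι S) (D : BalanceVars ι S) (past : History S)
    (c : Config S) : ∃ a, B.IndexAction D past c a := by
  by_cases h1 : ∃ i, lastAction past = some i ∧ B.Good D c i
  · obtain ⟨i, hi, hg⟩ := h1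
    exact ⟨some i, Or.inl ⟨i, hi, hg, rfl⟩⟩
  by_cases h2 : ∃ i, B.Good D c i
  · obtain ⟨i, hi⟩ := h2
    exact ⟨some i, Or.inr (Or.inl ⟨h1, i, hi, rfl⟩)⟩
  by_cases h3 : ∃ i, B.Ready D c i
  · obtain ⟨i, hi⟩ := h3
    exact ⟨some i, Or.inr (Or.inr (Or.inl ⟨h2, i, hi, rfl⟩))⟩
  · exact ⟨none, Or.inr (Or.inr (Or.inr ⟨h2, h3, rfl⟩))⟩

theorem BalanceOptimal.exists_isBalancedIndex [∀ i, Nonempty (S i)] {B : MonotoneBandit ι S}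
    {D : BalanceVars ι S} (hD : B.BalanceOptimal D) :
    ∃ (s : ∀ i, S i) (π : Policy S), B.IsBalancedIndex D s π := by
  let s₀ : ∀ i, S i := fun i => Classical.arbitrary (S i)
  by_cases h : B.AllTight D
  · choose a ha using B.exists_indexAction D
    refine ⟨s₀, fun past c => PMF.pure (a past c), Or.inl ⟨h, fun past c b hb => ?_⟩⟩
    rw [PMF.support_pure, Set.mem_singleton_iff] at hb
    exact hb ▸ ha past c
  · obtain ⟨i, hi, j, hf, hr⟩ := hD.exists_absorbing h
    refine ⟨Function.update s₀ i j, fun _ _ => PMF.pure (some i), Or.inr ⟨h, i, hi, ?_, ?_,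
      fun _ _ => rfl⟩⟩
    · rwa [Function.update_self]
    · rwa [Function.update_self]

/-! ### Drift inequalities -/

theorem reward_nonneg (B : MonotoneBandit ι S) (c : Config S) (a : Option ι) :
    0 ≤ B.reward c a := by
  cases a with
  | none => exact le_rfl
  | some i => exact B.r_nonneg i _

theorem reward_le (B : MonotoneBandit ι S) (c : Config S) (a : Option ι) :
    B.reward c a ≤ ∑ i, ∑ k, B.r i k := by
  have h : ∀ i, 0 ≤ ∑ k, B.r i k := fun i => Finset.sum_nonneg fun k _ => B.r_nonneg i k
  cases a with
  | none => exact Finset.sum_nonneg fun i _ => h i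
  | some i =>
    exact (Finset.single_le_sum (fun k _ => B.r_nonneg i k) (Finset.mem_univ (c i).1)).trans
      (Finset.single_le_sum (f := fun i => ∑ k, B.r i k) (fun i _ => h i) (Finset.mem_univ i))

theorem abs_reward_le (B : MonotoneBandit ι S) (c : Config S) (a : Option ι) :
    |B.reward c a| ≤ ∑ i, ∑ k, B.r i k := by
  rw [abs_of_nonneg (B.reward_nonneg c a)]
  exact B.reward_le c a

theorem expStepReward_eq (B : MonotoneBandit ι S) (π : Policy S) (c₀ : Config S) (T : ℕ) :
    B.expStepReward π c₀ T
      = (B.law π c₀ T).expect fun ω => (π ω.1 ω.2).expect (B.reward ω.2) := by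
  simp only [expStepReward, PMF.expect, tsum_fintype]

/-- Expectations ignore histories of probability zero, so drift inequalities need to hold only where
such an invariant does. -/
theorem law_invariant (B : MonotoneBandit ι S) (π : Policy S) (c₀ : Config S)
    (Inv : ℕ → History S × Config S → Prop) (h0 : Inv 0 ([], c₀))
    (hstep : ∀ u ω, Inv u ω → ∀ a ∈ (π ω.1 ω.2).support, ∀ c' ∈ (B.step ω.2 a).support,
      Inv (u + 1) ((ω.2, a) :: ω.1, c')) (u : ℕ) :
    ∀ ω ∈ (B.law π c₀ u).support, Inv u ω := by
  induction u with
  | zero =>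
    intro ω hω
    rw [law, PMF.support_pure, Set.mem_singleton_iff] at hω
    exact hω ▸ h0
  | succ u ih =>
    intro ω' hω'
    rw [law, PMF.mem_support_bind_iff] at hω'
    obtain ⟨ω, hω, h1⟩ := hω'
    rw [PMF.mem_support_bind_iff] at h1
    obtain ⟨a, ha, h2⟩ := h1
    rw [PMF.mem_support_map_iff] at h2
    obtain ⟨c', hc', rfl⟩ := h2
    exact hstep u ω (ih ω hω) a ha c' hc'

theorem expect_law_succ (B : MonotoneBandit ι S) (π : Policy S) (c₀ : Config S) (u : ℕ)
    {Φ : History S × Config S → ℝ} {C : ℝ} (hΦ : ∀ ω, |Φ ω| ≤ C) :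
    (B.law π c₀ (u + 1)).expect Φ = (B.law π c₀ u).expect fun ω => (π ω.1 ω.2).expect fun a =>
      (B.step ω.2 a).expect fun c' => Φ ((ω.2, a) :: ω.1, c') := by
  rw [law, PMF.expect_bind _ _ hΦ]
  congr 1
  funext ω
  rw [PMF.expect_bind _ _ hΦ]
  congr 1
  funext a
  rw [PMF.expect_map _ _ hΦ]

/-- Summing a drift inequality for the bounded potential `Φ` over the first `T` steps.  The sign
`σ` serves for lower and upper bounds on the reward. -/
theorem drift_sum (B : MonotoneBandit ι S) (π : Policy S) (c₀ : Config S) (σ κ : ℝ) (T : ℕ)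
    (Inv : ℕ → History S × Config S → Prop) (h0 : Inv 0 ([], c₀))
    (hstep : ∀ u ω, Inv u ω → ∀ a ∈ (π ω.1 ω.2).support, ∀ c' ∈ (B.step ω.2 a).support,
      Inv (u + 1) ((ω.2, a) :: ω.1, c'))
    {Φ : History S × Config S → ℝ} {C : ℝ} (hΦ : ∀ ω, |Φ ω| ≤ C)
    (hdrift : ∀ u ω, u < T → Inv u ω → ∀ a ∈ (π ω.1 ω.2).support,
      κ + Φ ω ≤ σ * B.reward ω.2 a
        + (B.step ω.2 a).expect fun c' => Φ ((ω.2, a) :: ω.1, c')) :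
    κ * T + Φ ([], c₀)
      ≤ σ * ∑ u ∈ Finset.range T, B.expStepReward π c₀ u + (B.law π c₀ T).expect Φ := by
  set R := ∑ i, ∑ k, B.r i k
  have hrew : ∀ (c : Config S) a, |σ * B.reward c a| ≤ |σ| * R := fun c a => by
    rw [abs_mul]
    exact mul_le_mul_of_nonneg_left (B.abs_reward_le c a) (abs_nonneg σ)
  have hE : ∀ (ω : History S × Config S) a,
      |(B.step ω.2 a).expect fun c' => Φ ((ω.2, a) :: ω.1, c')| ≤ C := fun ω a =>
    PMF.abs_expect_le _ fun c' => hΦ _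
  have hone : ∀ u < T, κ + (B.law π c₀ u).expect Φ
      ≤ σ * B.expStepReward π c₀ u + (B.law π c₀ (u + 1)).expect Φ := fun u hu => by
    have h1 : ∀ ω ∈ (B.law π c₀ u).support, κ + Φ ω ≤ σ * (π ω.1 ω.2).expect (B.reward ω.2)
        + (π ω.1 ω.2).expect fun a =>
          (B.step ω.2 a).expect fun c' => Φ ((ω.2, a) :: ω.1, c') := fun ω hω => by
      rw [← PMF.expect_const_mul, ← PMF.expect_add _ (hrew ω.2) (hE ω),
        ← PMF.expect_const (π ω.1 ω.2) (κ + Φ ω)]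
      exact PMF.expect_mono _ (C := |κ + Φ ω|) (fun _ => le_rfl)
        (fun a => (abs_add_le _ _).trans (add_le_add (hrew ω.2 a) (hE ω a)))
        (hdrift u ω hu (B.law_invariant π c₀ Inv h0 hstep u ω hω))
    have hrew' : ∀ ω : History S × Config S,
        |σ * (π ω.1 ω.2).expect (B.reward ω.2)| ≤ |σ| * R := fun ω => by
      rw [← PMF.expect_const_mul]
      exact PMF.abs_expect_le _ (hrew ω.2)
    have hE' : ∀ ω : History S × Config S, |(π ω.1 ω.2).expect fun a =>
        (B.step ω.2 a).expect fun c' => Φ ((ω.2, a) :: ω.1, c')| ≤ C := fun ω =>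
      PMF.abs_expect_le _ (hE ω)
    have hκ : ∀ _ω : History S × Config S, |κ| ≤ |κ| := fun _ => le_rfl
    rw [expStepReward_eq, expect_law_succ B π c₀ u hΦ, ← PMF.expect_const_mul,
      ← PMF.expect_add _ hrew' hE', ← PMF.expect_const (B.law π c₀ u) κ,
      ← PMF.expect_add _ hκ hΦ]
    exact PMF.expect_mono _ (fun ω => (abs_add_le _ _).trans (add_le_add (hκ ω) (hΦ ω)))
      (fun ω => (abs_add_le _ _).trans (add_le_add (hrew' ω) (hE' ω))) h1
  have hall : ∀ n ≤ T, κ * n + Φ ([], c₀)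
      ≤ σ * ∑ u ∈ Finset.range n, B.expStepReward π c₀ u + (B.law π c₀ n).expect Φ := by
    intro n
    induction n with
    | zero => intro _; simp [law, PMF.expect_pure]
    | succ n ih =>
      intro hn
      have h1 := ih (by omega)
      have h2 := hone n (by omega)
      rw [Finset.sum_range_succ]
      push_cast
      linarith
  exact hall T le_rfl

/-! ### One-step expectations of additive potentials -/

theorem expect_nextState (B : MonotoneBandit ι S) (i : ι) (k : S i) (t : ℕ+) (g : S i → ℝ) :
    (B.nextState i k t).expect g
      = g k + B.f i k t * ∑ j ∈ Finset.univ.erase k, B.q i k j * (g j - g k) := by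
  have h1 : (B.nextState i k t).expect g = ∑ j, B.transProb i k t j * g j := by
    rw [PMF.expect, tsum_fintype]
    refine Finset.sum_congr rfl fun j _ => ?_
    rw [nextState, PMF.ofFintype_apply, ENNReal.toReal_ofReal (B.transProb_nonneg i k t j)]
  have h2 : ∑ j ∈ Finset.univ.erase k, B.transProb i k t j * g j
      = ∑ j ∈ Finset.univ.erase k, B.f i k t * B.q i k j * g j :=
    Finset.sum_congr rfl fun j hj => by simp [transProb, Finset.ne_of_mem_erase hj]
  rw [h1, ← Finset.add_sum_erase _ _ (Finset.mem_univ k), h2, transProb, if_pos rfl, sub_mul,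
    one_mul, Finset.sum_mul, Finset.mul_sum, sub_add, ← Finset.sum_sub_distrib, sub_eq_add_neg,
    ← Finset.sum_neg_distrib]
  congr 1
  exact Finset.sum_congr rfl fun j _ => by ring

theorem expect_step_some (B : MonotoneBandit ι S) (c : Config S) (i : ι)
    {φ : ∀ l, S l × ℕ+ → ℝ} {C : ℝ} (hφ : ∀ c : Config S, |∑ l, φ l (c l)| ≤ C) :
    ((B.step c (some i)).expect fun c' => ∑ l, φ l (c' l))
      = ∑ l ∈ Finset.univ.erase i, φ l ((c l).1, (c l).2 + 1) + φ i ((c i).1, 1)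
        + B.f i (c i).1 (c i).2 * ∑ j ∈ Finset.univ.erase (c i).1,
          B.q i (c i).1 j * (φ i (j, 1) - φ i ((c i).1, 1)) := by
  have h : ∀ j : S i, ∑ l, φ l (Function.update (wait c) i (j, 1) l)
      = ∑ l ∈ Finset.univ.erase i, φ l ((c l).1, (c l).2 + 1) + φ i (j, 1) := fun j => by
    rw [← Finset.sum_erase_add _ _ (Finset.mem_univ i), Function.update_self]
    congr 1
    exact Finset.sum_congr rfl fun l hl => by
      rw [Function.update_of_ne (Finset.ne_of_mem_erase hl)]; rfl
  rw [step, PMF.expect_map _ _ hφ]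
  simp only [h]
  rw [expect_nextState]
  simp only [add_sub_add_left_eq_sub]

theorem expect_step_none (B : MonotoneBandit ι S) (c : Config S) (φ : ∀ l, S l × ℕ+ → ℝ) :
    ((B.step c none).expect fun c' => ∑ l, φ l (c' l)) = ∑ l, φ l ((c l).1, (c l).2 + 1) := by
  rw [step, PMF.expect_pure]
  rfl

theorem mem_support_step_some {B : MonotoneBandit ι S} {c c' : Config S} {i : ι}
    (h : c' ∈ (B.step c (some i)).support) :
    ∃ j ∈ (B.nextState i (c i).1 (c i).2).support, c' = Function.update (wait c) i (j, 1) := by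
  rw [step, PMF.mem_support_map_iff] at h
  obtain ⟨j, hj, rfl⟩ := h
  exact ⟨j, hj, rfl⟩

/-! ### Long-term averages -/

theorem sum_expStepReward_bounds (B : MonotoneBandit ι S) (π : Policy S) (c₀ : Config S)
    (T : ℕ) : 0 ≤ ∑ u ∈ Finset.range T, B.expStepReward π c₀ u ∧
      ∑ u ∈ Finset.range T, B.expStepReward π c₀ u ≤ (∑ i, ∑ k, B.r i k) * T := by
  have hE : ∀ c : History S × Config S,
      |(π c.1 c.2).expect (B.reward c.2)| ≤ ∑ i, ∑ k, B.r i k := fun c =>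
    PMF.abs_expect_le _ (B.abs_reward_le c.2)
  have h1 : ∀ u, 0 ≤ B.expStepReward π c₀ u := fun u =>
    tsum_nonneg fun ω => mul_nonneg ENNReal.toReal_nonneg <| Finset.sum_nonneg fun a _ =>
      mul_nonneg ENNReal.toReal_nonneg (B.reward_nonneg _ _)
  have h2 : ∀ u, B.expStepReward π c₀ u ≤ ∑ i, ∑ k, B.r i k := fun u => by
    rw [expStepReward_eq]
    exact (le_abs_self _).trans (PMF.abs_expect_le _ hE)
  refine ⟨Finset.sum_nonneg fun u _ => h1 u, (Finset.sum_le_sum fun u _ => h2 u).trans ?_⟩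
  rw [Finset.sum_const, Finset.card_range, nsmul_eq_mul, mul_comm]

theorem avgReward_nonneg (B : MonotoneBandit ι S) (π : Policy S) (s : ∀ i, S i) (T : ℕ) :
    0 ≤ B.avgReward π s T :=
  div_nonneg (B.sum_expStepReward_bounds π (start s) T).1 (Nat.cast_nonneg T)

theorem avgReward_le (B : MonotoneBandit ι S) (π : Policy S) (s : ∀ i, S i) (T : ℕ) :
    B.avgReward π s T ≤ ∑ i, ∑ k, B.r i k := by
  refine div_le_of_le_mul₀ (Nat.cast_nonneg T) ?_ (B.sum_expStepReward_bounds π (start s) T).2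
  exact Finset.sum_nonneg fun i _ => Finset.sum_nonneg fun k _ => B.r_nonneg i k

theorem tendsto_const_add_div (κ C : ℝ) :
    Tendsto (fun T : ℕ => κ + C / T) atTop (nhds κ) := by
  simpa using (tendsto_const_div_atTop_nhds_zero_nat C).const_add κ

theorem le_liminf_avgReward (B : MonotoneBandit ι S) (π : Policy S) (s : ∀ i, S i) (κ C : ℝ)
    (h : ∀ T : ℕ, κ * T - C ≤ ∑ u ∈ Finset.range T, B.expStepReward π (start s) u) :
    κ ≤ liminf (B.avgReward π s) atTop := by
  have ht := tendsto_const_add_div κ (-C)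
  rw [← ht.liminf_eq]
  -- The real-valued `liminf` is monotone only under boundedness, which the uniform bound on rewards
  -- provides.
  refine liminf_le_liminf ?_ ht.isBoundedUnder_ge
    (isBoundedUnder_of ⟨_, B.avgReward_le π s⟩).isCoboundedUnder_ge
  filter_upwards [eventually_gt_atTop 0] with T hT
  have hT' : (0 : ℝ) < T := by exact_mod_cast hT
  rw [avgReward, le_div_iff₀ hT', add_mul, div_mul_cancel₀ _ hT'.ne']
  linarith [h T]

theorem limsup_avgReward_le (B : MonotoneBandit ι S) (π : Policy S) (s : ∀ i, S i) (κ C : ℝ)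
    (h : ∀ T : ℕ, ∑ u ∈ Finset.range T, B.expStepReward π (start s) u ≤ κ * T + C) :
    limsup (B.avgReward π s) atTop ≤ κ := by
  have ht := tendsto_const_add_div κ C
  rw [← ht.limsup_eq]
  refine limsup_le_limsup ?_
    (isBoundedUnder_of ⟨_, B.avgReward_nonneg π s⟩).isCoboundedUnder_le ht.isBoundedUnder_le
  filter_upwards [eventually_gt_atTop 0] with T hT
  have hT' : (0 : ℝ) < T := by exact_mod_cast hT
  rw [avgReward, div_le_iff₀ hT', add_mul, div_mul_cancel₀ _ hT'.ne']
  exact h T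

theorem abs_sum_config_le {ι : Type*} {S : ι → Type*} [Fintype ι] {φ : ∀ l, S l × ℕ+ → ℝ}
    {M : ι → ℝ} (h : ∀ l x, |φ l x| ≤ M l) (c : Config S) : |∑ l, φ l (c l)| ≤ ∑ l, M l :=
  (Finset.abs_sum_le_sum_abs _ _).trans (Finset.sum_le_sum fun l _ => h l (c l))

theorem abs_p_le {ι : Type*} {S : ι → Type*} [∀ i, Fintype (S i)] (D : BalanceVars ι S) (l : ι)
    (k : S l) : |D.p l k| ≤ ∑ j, |D.p l j| :=
  Finset.single_le_sum (f := fun j => |D.p l j|) (fun j _ => abs_nonneg (D.p l j))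
    (Finset.mem_univ k)

/-! ### Upper bound for all policies -/

/-- Negative of the dual potential in which each retained arm accrues `h l` per step of waiting,
truncated at `N`. -/
def waitPotential (D : BalanceVars ι S) (N : ℝ) (l : ι) (x : S l × ℕ+) : ℝ :=
  -(D.p l x.1 + D.h l * min (x.2 : ℝ) N)

/-- While the truncation is inactive, waiting adds `∑ l, h l` to the dual potential. Playing `i`
after `t` steps also releases `t * h i` and adds `f * ΔP`, so the claim is exactly the dual
constraint at `t`. -/
theorem BalanceFeasible.waitPotential_drift {B : MonotoneBandit ι S} {D : BalanceVars ι S}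
    (hD : B.BalanceFeasible D) {N : ℝ} (hN : 1 ≤ N) {C : ℝ}
    (hC : ∀ c : Config S, |∑ l, waitPotential D N l (c l)| ≤ C) (c : Config S)
    (hc : ∀ l, (((c l).2 : ℕ) : ℝ) + 1 ≤ N) (a : Option ι) :
    -(D.lam + ∑ l, D.h l) + ∑ l, waitPotential D N l (c l) ≤ -1 * B.reward c a
      + (B.step c a).expect fun c' => ∑ l, waitPotential D N l (c' l) := by
  have hold : ∀ l, waitPotential D N l (c l) = -(D.p l (c l).1 + D.h l * (c l).2) := fun l => by
    rw [waitPotential, min_eq_left (by linarith [hc l])]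
  have hnew : ∀ l, waitPotential D N l ((c l).1, (c l).2 + 1)
      = waitPotential D N l (c l) - D.h l := fun l => by
    rw [hold, waitPotential]
    dsimp only
    rw [PNat.add_coe, PNat.one_coe, Nat.cast_add, Nat.cast_one, min_eq_left (hc l)]
    ring
  cases a with
  | none =>
    rw [expect_step_none]
    simp only [hnew, Finset.sum_sub_distrib, reward]
    linarith [hD.lam_nonneg]
  | some i =>
    have hone : ∀ j, waitPotential D N i (j, 1) = -(D.p i j + D.h i) := fun j => by
      simp [waitPotential, hN]
    have hΔ : ∑ j ∈ Finset.univ.erase (c i).1, B.q i (c i).1 j *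
        (-(D.p i j + D.h i) - -(D.p i (c i).1 + D.h i)) = -B.deltaP D i (c i).1 := by
      rw [deltaP, ← Finset.sum_neg_distrib]
      exact Finset.sum_congr rfl fun j _ => by ring
    rw [expect_step_some B c i hC]
    simp only [hnew, Finset.sum_sub_distrib, hone, hΔ]
    rw [← Finset.sum_erase_add Finset.univ D.h (Finset.mem_univ i),
      ← Finset.sum_erase_add Finset.univ (fun l => waitPotential D N l (c l))
        (Finset.mem_univ i), hold i]
    have := hD.dual_all i (c i).1 (c i).2
    simp only [reward]
    linarith

theorem BalanceFeasible.sum_expStepReward_le {B : MonotoneBandit ι S} {D : BalanceVars ι S}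
    (hD : B.BalanceFeasible D) (π : Policy S) (s : ∀ i, S i) (T : ℕ) :
    ∑ u ∈ Finset.range T, B.expStepReward π (start s) u ≤ (D.lam + ∑ l, D.h l) * T
      + (∑ l, ∑ k, |D.p l k| + ∑ l, (∑ k, |D.p l k| + D.h l)) := by
  -- Truncation makes the potential bounded. After `u < T` steps clocks are at most `u + 1 ≤ T`, so
  -- it has no effect within the horizon.
  set N : ℝ := (T : ℝ) + 1 with hN
  have hN1 : 1 ≤ N := by rw [hN]; linarith [Nat.cast_nonneg (α := ℝ) T]
  have hmin : ∀ y : ℕ+, 0 ≤ min (y : ℝ) N ∧ min (y : ℝ) N ≤ N := fun y =>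
    ⟨le_min (Nat.cast_nonneg _) (by linarith), min_le_right _ _⟩
  have hup : ∀ l x, waitPotential D N l x ≤ ∑ k, |D.p l k| := fun l x => by
    have h1 := (abs_le.1 (abs_p_le D l x.1)).1
    have h2 := mul_nonneg (hD.h_nonneg l) (hmin x.2).1
    rw [waitPotential]
    linarith
  have hM : ∀ l x, |waitPotential D N l x| ≤ ∑ k, |D.p l k| + D.h l * N := fun l x => by
    have h1 := (abs_le.1 (abs_p_le D l x.1)).2
    have h2 := mul_le_mul_of_nonneg_left (hmin x.2).2 (hD.h_nonneg l)
    have h3 := mul_nonneg (hD.h_nonneg l) (zero_le_one.trans hN1)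
    refine abs_le.2 ⟨?_, (hup l x).trans (by linarith)⟩
    rw [waitPotential]
    linarith
  have hC := abs_sum_config_le hM
  have hdrift := B.drift_sum π (start s) (-1) (-(D.lam + ∑ l, D.h l)) T
    (fun u ω => ∀ l, ((ω.2 l).2 : ℕ) ≤ u + 1) (fun l => le_rfl)
    (fun u ω hω a _ c' hc' l => by
      have hw : ((wait ω.2 l).2 : ℕ) ≤ u + 1 + 1 := Nat.succ_le_succ (hω l)
      cases a with
      | none =>
        rw [step, PMF.support_pure, Set.mem_singleton_iff] at hc'
        exact hc' ▸ hw
      | some i =>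
        obtain ⟨j, -, rfl⟩ := mem_support_step_some hc'
        by_cases hl : l = i
        · subst hl
          simp
        · simpa only [Function.update_of_ne hl] using hw)
    (Φ := fun ω => ∑ l, waitPotential D N l (ω.2 l)) (fun ω => hC ω.2)
    (fun u ω hu hω a _ => hD.waitPotential_drift hN1 hC ω.2 (fun l => by
      have h1 : ((ω.2 l).2 : ℕ) + 1 ≤ T + 1 := by have := hω l; omega
      rw [hN]
      exact_mod_cast h1) a)
  -- Only the upper bound `hup` is used here; it does not involve `N`, so the error term is
  -- independent of `T`.
  have hfin : (B.law π (start s) T).expect (fun ω => ∑ l, waitPotential D N l (ω.2 l))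
      ≤ ∑ l, ∑ k, |D.p l k| := by
    rw [← PMF.expect_const (B.law π (start s) T) (∑ l, ∑ k, |D.p l k|)]
    exact PMF.expect_mono _ (fun ω => hC ω.2) (C' := |(∑ l, ∑ k, |D.p l k|)|) (fun _ => le_rfl)
      fun ω _ => Finset.sum_le_sum fun l _ => hup l _
  have hinit : -∑ l, (∑ k, |D.p l k| + D.h l)
      ≤ ∑ l, waitPotential D N l (start s l) := by
    rw [← Finset.sum_neg_distrib]
    refine Finset.sum_le_sum fun l _ => ?_
    have h1 := (abs_le.1 (abs_p_le D l (s l))).2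
    simp only [waitPotential, start, PNat.one_coe, Nat.cast_one, min_eq_left hN1, mul_one]
    linarith
  dsimp only at hdrift
  linarith

/-! ### Lower bound for the index rule -/

/-- When `ΔP < 0`, `r + f t * ΔP` is nonincreasing in `t` while `λ + t * h` strictly increases, so
feasibility at 1 excludes later tight times. -/
theorem BalanceFeasible.tight_eq_one {B : MonotoneBandit ι S} {D : BalanceVars ι S}
    (hD : B.BalanceFeasible D) {i : ι} (hi : 0 < D.h i) {k : S i} (hk : B.deltaP D i k < 0)
    {t : ℕ+} (ht : t ∈ B.tightTimes D i k) : t = 1 := by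
  have h1 := hD.dual i k 1 (B.one_mem_W i k)
  have h2 := mul_le_mul_of_nonpos_right (B.f_monotone i k (one_le (a := t))) hk.le
  have h3 := ht.2
  rw [PNat.one_coe, Nat.cast_one, one_mul] at h1
  have h4 : (t : ℝ) * D.h i ≤ 1 * D.h i := by linarith
  have h5 : ((t : ℕ) : ℝ) ≤ 1 := le_of_mul_le_mul_right h4 hi
  exact le_antisymm (by exact_mod_cast h5) one_le

/-- The potential of the index rule: a retained arm accrues `h l` per step of waiting until its
smallest tight time `τ l k`; good arms that were not played in the last step are penalized. -/
def indexPotential (B : MonotoneBandit ι S) (D : BalanceVars ι S) (τ : ∀ l, S l → ℕ+) (K : ℝ)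
    (a : Option ι) (l : ι) (x : S l × ℕ+) : ℝ :=
  if 0 < D.h l then D.p l x.1 + D.h l * ((min x.2 (τ l x.1) : ℕ+) : ℝ)
    - (if B.deltaP D l x.1 < 0 ∧ a ≠ some l then K else 0) else 0

/-- For an unplayed arm the accrued term cannot fall, and by `ha` a penalty due after the step was
already charged before it. -/
theorem indexPotential_wait_le {B : MonotoneBandit ι S} {D : BalanceVars ι S}
    {τ : ∀ l, S l → ℕ+} {K : ℝ} (hK : 0 ≤ K) (a a' : Option ι) (l : ι) (k : S l) (y : ℕ+)
    (ha : 0 < D.h l → B.deltaP D l k < 0 → a ≠ some l) :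
    indexPotential B D τ K a l (k, y) ≤ indexPotential B D τ K a' l (k, y + 1) := by
  have hmin : ((min y (τ l k) : ℕ+) : ℝ) ≤ ((min (y + 1) (τ l k) : ℕ+) : ℝ) := by
    exact_mod_cast min_le_min_right (τ l k) (PNat.lt_add_right y 1).le
  unfold indexPotential
  split_ifs with h1 h2 h3 h3
  · linarith [mul_le_mul_of_nonneg_left hmin h1.le]
  · linarith [mul_le_mul_of_nonneg_left hmin h1.le]
  · exact absurd ⟨h3.1, ha h1 h3.1⟩ h2
  · linarith [mul_le_mul_of_nonneg_left hmin h1.le]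
  · exact le_rfl

/-- Right after its play arm `i` has clock 1 and no penalty, so its potential is `p + h` in every
state. With the other arms not losing, the drift reduces to `hmain` for arm `i` alone. -/
theorem indexPotential_play {B : MonotoneBandit ι S} {D : BalanceVars ι S} {τ : ∀ l, S l → ℕ+}
    {K C : ℝ} (hK : 0 ≤ K) {c : Config S} {a : Option ι} {i : ι} (hi : 0 < D.h i)
    (hC : ∀ c : Config S, |∑ l, indexPotential B D τ K (some i) l (c l)| ≤ C)
    (hother : ∀ l, l ≠ i → 0 < D.h l → B.deltaP D l (c l).1 < 0 → a ≠ some l)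
    (hmain : D.lam + indexPotential B D τ K a i (c i) ≤ B.r i (c i).1
      + B.f i (c i).1 (c i).2 * B.deltaP D i (c i).1 + D.p i (c i).1 + D.h i) :
    D.lam + ∑ l, indexPotential B D τ K a l (c l) ≤ 1 * B.reward c (some i)
      + (B.step c (some i)).expect fun c' =>
        ∑ l, indexPotential B D τ K (some i) l (c' l) := by
  have hone : ∀ j, indexPotential B D τ K (some i) i (j, 1) = D.p i j + D.h i := fun j => by
    simp [indexPotential, hi]
  rw [expect_step_some B c i hC,
    ← Finset.sum_erase_add Finset.univ _ (Finset.mem_univ i)]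
  have h1 : ∑ l ∈ Finset.univ.erase i, indexPotential B D τ K a l (c l)
      ≤ ∑ l ∈ Finset.univ.erase i,
        indexPotential B D τ K (some i) l ((c l).1, (c l).2 + 1) :=
    Finset.sum_le_sum fun l hl =>
      indexPotential_wait_le hK a (some i) l (c l).1 (c l).2
        (hother l (Finset.ne_of_mem_erase hl))
  simp only [hone, add_sub_add_right_eq_sub, reward]
  rw [deltaP] at hmain
  linarith

theorem BalanceFeasible.indexPotential_drift {B : MonotoneBandit ι S} {D : BalanceVars ι S}
    (hD : B.BalanceFeasible D) {τ : ∀ l, S l → ℕ+}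
    (hτ : ∀ l, 0 < D.h l → ∀ k, IsLeast (B.tightTimes D l k) (τ l k)) {K C : ℝ} (hK : 0 ≤ K)
    (hKΔ : ∀ i k, D.lam + |B.deltaP D i k| ≤ K)
    (hC : ∀ a, ∀ c : Config S, |∑ l, indexPotential B D τ K a l (c l)| ≤ C)
    {past : History S} {c : Config S} (hlast : ∀ i, lastAction past = some i → (c i).2 = 1)
    {a : Option ι} (ha : B.IndexAction D past c a) :
    D.lam + ∑ l, indexPotential B D τ K (lastAction past) l (c l) ≤ 1 * B.reward c a
      + (B.step c a).expect fun c' => ∑ l, indexPotential B D τ K a l (c' l) := by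
  have hgood : ∀ i, B.Good D c i → D.lam + D.h i
      = B.r i (c i).1 + B.f i (c i).1 1 * B.deltaP D i (c i).1 ∧ τ i (c i).1 = 1 := fun i hi => by
    have h1 := (hτ i hi.1 (c i).1).1
    have h2 := hD.tight_eq_one hi.1 hi.2 h1
    have h3 := h1.2
    rw [h2, PNat.one_coe, Nat.cast_one, one_mul] at h3
    exact ⟨h3, h2⟩
  rcases ha with ⟨i, hi, hg, rfl⟩ | ⟨hno, i, hg, rfl⟩ | ⟨hno, i, hr, rfl⟩ | ⟨hno, hnr, rfl⟩
  -- Good arm just played: clock and tight time are both 1, and the tight constraint gives equality.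
  · obtain ⟨h1, h2⟩ := hgood i hg
    refine indexPotential_play hK hg.1 (hC (some i)) (fun l hl _ _ h => hl ?_) ?_
    · rw [hi] at h
      exact (Option.some_injective _ h).symm
    · rw [indexPotential, if_pos hg.1, if_neg (fun h => h.2 hi), h2, hlast i hi]
      simp only [min_self, PNat.one_coe, Nat.cast_one, mul_one]
      linarith [hg.1]
  -- Good arm not just played: its clock is arbitrary, but the released penalty `K` covers `λ` and
  -- the loss of at most `|ΔP|`.
  · obtain ⟨-, h2⟩ := hgood i hg
    refine indexPotential_play hK hg.1 (hC (some i))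
      (fun l _ hl hΔ h => hno ⟨l, h, hl, hΔ⟩) ?_
    rw [indexPotential, if_pos hg.1, if_pos ⟨hg.2, fun h => hno ⟨i, h, hg⟩⟩, h2,
      min_eq_right one_le]
    simp only [PNat.one_coe, Nat.cast_one, mul_one]
    have h3 := mul_le_mul_of_nonpos_right (B.f_le_one i (c i).1 (c i).2) hg.2.le
    have h4 := neg_abs_le (B.deltaP D i (c i).1)
    linarith [hKΔ i (c i).1, B.r_nonneg i (c i).1, hD.lam_nonneg]
  -- Ready arm: the accrual stopped at the tight time `t`, and since `ΔP ≥ 0` a later play, with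
  -- larger `f`, is at least as good as one at `t`.
  · obtain ⟨hi, hΔ, t, ht, hle⟩ := hr
    have hτt : τ i (c i).1 = t := (hτ i hi _).unique ht
    refine indexPotential_play hK hi (hC (some i))
      (fun l _ hl hΔ _ => hno ⟨l, hl, hΔ⟩) ?_
    rw [indexPotential, if_pos hi, if_neg (fun h => h.1.not_ge hΔ), hτt, min_eq_right hle]
    have h1 := mul_le_mul_of_nonneg_right (B.f_monotone i (c i).1 hle) hΔ
    have h2 := ht.1.2
    linarith
  -- Idle step: every retained arm is strictly before its tight time and accrues `h l`; by balance
  -- this totals `λ`.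
  · rw [expect_step_none, hD.balance]
    have h1 : ∀ l, D.h l + indexPotential B D τ K (lastAction past) l (c l)
        ≤ indexPotential B D τ K none l ((c l).1, (c l).2 + 1) := fun l => by
      rcases (hD.h_nonneg l).eq_or_lt with h0 | h0
      · simp [indexPotential, ← h0]
      have hΔ : ¬ B.deltaP D l (c l).1 < 0 := fun h => hno ⟨l, h0, h⟩
      have hlt : (c l).2 < τ l (c l).1 := not_le.1 fun h =>
        hnr ⟨l, h0, not_lt.1 hΔ, _, hτ l h0 _, h⟩
      simp only [indexPotential, if_pos h0, hΔ, false_and, if_false, min_eq_left hlt.le,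
        min_eq_left (PNat.add_one_le_iff.2 hlt), PNat.add_coe, PNat.one_coe, Nat.cast_add,
        Nat.cast_one]
      linarith
    have h2 := Finset.sum_le_sum fun l (_ : l ∈ Finset.univ) => h1 l
    rw [Finset.sum_add_distrib] at h2
    simp only [reward]
    linarith

theorem BalanceFeasible.le_liminf_of_indexAction {B : MonotoneBandit ι S} {D : BalanceVars ι S}
    (hD : B.BalanceFeasible D) (htight : B.AllTight D) (s : ∀ i, S i) {π : Policy S}
    (hπ : ∀ past c, ∀ a ∈ (π past c).support, B.IndexAction D past c a) :
    D.lam ≤ liminf (B.avgReward π s) atTop := by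
  have hex : ∀ l k, ∃ t : ℕ+, 0 < D.h l → IsLeast (B.tightTimes D l k) t := fun l k => by
    by_cases h : 0 < D.h l
    · obtain ⟨t, ht⟩ := WellFounded.has_min wellFounded_lt _ (htight l h k)
      exact ⟨t, fun _ => ⟨ht.1, fun u hu => not_lt.1 (ht.2 u hu)⟩⟩
    · exact ⟨1, fun h' => absurd h' h⟩
  choose τ hτ using hex
  set K : ℝ := D.lam + ∑ i, ∑ k, |B.deltaP D i k| with hKdef
  have hKΔ : ∀ i k, D.lam + |B.deltaP D i k| ≤ K := fun i k => by
    refine add_le_add_right ((Finset.single_le_sum (f := fun k => |B.deltaP D i k|)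
      (fun k _ => abs_nonneg _) (Finset.mem_univ k)).trans
      (Finset.single_le_sum (f := fun i => ∑ k, |B.deltaP D i k|)
        (fun i _ => Finset.sum_nonneg fun k _ => abs_nonneg _) (Finset.mem_univ i))) _
  have hK : 0 ≤ K := add_nonneg hD.lam_nonneg
    (Finset.sum_nonneg fun i _ => Finset.sum_nonneg fun k _ => abs_nonneg _)
  -- Stopping the clocks at `τ` bounds the potential uniformly in time, so no truncation depending
  -- on the horizon is needed.
  set M : ι → ℝ := fun l => ∑ k, |D.p l k| + D.h l * ∑ k, ((τ l k : ℕ+) : ℝ) + K with hMdef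
  have hM : ∀ a l x, |indexPotential B D τ K a l x| ≤ M l := fun a l x => by
    have hp := abs_le.1 (abs_p_le D l x.1)
    have hsτ : ((τ l x.1 : ℕ+) : ℝ) ≤ ∑ k, ((τ l k : ℕ+) : ℝ) :=
      Finset.single_le_sum (f := fun k => ((τ l k : ℕ+) : ℝ)) (fun k _ => Nat.cast_nonneg _)
        (Finset.mem_univ x.1)
    have hmin : ((min x.2 (τ l x.1) : ℕ+) : ℝ) ≤ ((τ l x.1 : ℕ+) : ℝ) := by
      exact_mod_cast min_le_right x.2 (τ l x.1)
    have h1 := mul_le_mul_of_nonneg_left (hmin.trans hsτ) (hD.h_nonneg l)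
    have h2 := mul_nonneg (hD.h_nonneg l) (Nat.cast_nonneg (α := ℝ) (min x.2 (τ l x.1) : ℕ+))
    simp only [hMdef]
    unfold indexPotential
    split_ifs <;> refine abs_le.2 ⟨?_, ?_⟩ <;> linarith
  have hC := fun a => abs_sum_config_le (hM a)
  refine B.le_liminf_avgReward π s D.lam (∑ l, M l + ∑ l, M l) fun T => ?_
  have hdrift := B.drift_sum π (start s) 1 D.lam T
    (fun _ ω => ∀ i, lastAction ω.1 = some i → (ω.2 i).2 = 1)
    (fun i h => by simp [lastAction] at h)
    (fun u ω _ a _ c' hc' i hi => by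
      have hi' : a = some i := hi
      subst hi'
      obtain ⟨j, -, rfl⟩ := mem_support_step_some hc'
      simp)
    (Φ := fun ω => ∑ l, indexPotential B D τ K (lastAction ω.1) l (ω.2 l))
    (fun ω => hC _ ω.2)
    (fun u ω _ hω a ha => hD.indexPotential_drift (fun l h k => hτ l k h) hK hKΔ hC hω
      (hπ ω.1 ω.2 a ha))
  have h1 := (abs_le.1 (PMF.abs_expect_le (B.law π (start s) T)
    (fun ω => hC (lastAction ω.1) ω.2))).2
  have h2 := (abs_le.1 (hC (lastAction (S := S) []) (start s))).1
  dsimp only at hdrift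
  linarith

/-! ### Lower bound for the trivial policy -/

theorem eq_of_mem_support_nextState {B : MonotoneBandit ι S} {i : ι} {k j : S i} {t : ℕ+}
    (hf : B.f i k t = 0) (hj : j ∈ (B.nextState i k t).support) : j = k := by
  by_contra hne
  rw [nextState, PMF.mem_support_ofFintype_iff] at hj
  simp [transProb, hne, hf] at hj

/-- An arm played in every step always has clock 1, so `f = 0` at time 1 already keeps it in its
start state, and the zero potential suffices. -/
theorem le_liminf_of_absorbing (B : MonotoneBandit ι S) (s : ∀ i, S i) {π : Policy S} {i : ι}
    (hf : B.f i (s i) 1 = 0) (hπ : ∀ past c, π past c = PMF.pure (some i)) :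
    B.r i (s i) ≤ liminf (B.avgReward π s) atTop := by
  refine B.le_liminf_avgReward π s _ 0 fun T => ?_
  have hdrift := B.drift_sum π (start s) 1 (B.r i (s i)) T
    (fun _ ω => ω.2 i = (s i, 1)) rfl
    (fun u ω hω a ha c' hc' => by
      rw [hπ, PMF.support_pure, Set.mem_singleton_iff] at ha
      subst ha
      obtain ⟨j, hj, rfl⟩ := mem_support_step_some hc'
      rw [hω] at hj
      simp [eq_of_mem_support_nextState hf hj])
    (Φ := fun _ => 0) (C := 0) (fun _ => by simp)
    (fun u ω _ hω a ha => by
      rw [hπ, PMF.support_pure, Set.mem_singleton_iff] at ha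
      subst ha
      simp [PMF.expect_const, reward, hω])
  simp only [PMF.expect_const] at hdrift
  linarith

end MonotoneBandit

end

theorem mainTheorem2 {ι : Type*} {S : ι → Type*} [Fintype ι] [DecidableEq ι]
    [∀ i, Fintype (S i)] [∀ i, DecidableEq (S i)] [∀ i, Nonempty (S i)]
    (B : MonotoneBandit ι S) :
    (∃ D : BalanceVars ι S, B.BalanceOptimal D) ∧
    ∀ D : BalanceVars ι S, B.BalanceOptimal D →
      (∃ (s : ∀ i, S i) (π : MonotoneBandit.Policy S), B.IsBalancedIndex D s π) ∧
      ∀ (s : ∀ i, S i) (π : MonotoneBandit.Policy S), B.IsBalancedIndex D s π →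
        B.OPT / 2 ≤ Filter.liminf (B.avgReward π s) Filter.atTop ∧
        ∀ (s' : ∀ i, S i) (π' : MonotoneBandit.Policy S),
          Filter.limsup (B.avgReward π' s') Filter.atTop
            ≤ 2 * Filter.liminf (B.avgReward π s) Filter.atTop := by
  refine ⟨B.exists_balanceOptimal, fun D hD => ⟨hD.exists_isBalancedIndex, fun s π hπ => ?_⟩⟩
  have hlow : D.lam ≤ Filter.liminf (B.avgReward π s) Filter.atTop := by
    rcases hπ with ⟨htight, hπ⟩ | ⟨-, i, hi, hf, hr, hπ⟩
    · exact hD.1.le_liminf_of_indexAction htight s hπ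
    · have h := B.le_liminf_of_absorbing s hf hπ
      linarith
  -- Balance turns both upper bounds `λ + ∑ l, h l` into `2λ`.
  have hbal := hD.1.balance
  refine ⟨?_, fun s' π' => ?_⟩
  · have h := hD.1.OPT_le
    linarith
  · have h := B.limsup_avgReward_le π' s' _ _ (hD.1.sum_expStepReward_le π' s')
    linarith
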